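/- Let $d\ge 1$ and $m\ge 1$ be integers, let $c$ be an indeterminate, and let $f(z)=z^{d+1}+cz\in\mathbb Z[c][z]$. Write $f^{\circ k}$ for the $k$-th iterate of $f$, and let $$\Phi_m^*(z)=\prod_{k\mid m}\bigl(f^{\circ k}(z)-z\bigr)^{\mu(m/k)}$$ be the $m$-th dynatomic polynomial of $f$ (this product is a polynomial in $\mathbb Z[c][z]$). Let $\delta_m(x)$ be the $m$-th multiplier polynomial of $f$, that is, the unique monic polynomial in $x$ over an algebraic closure $\overline{\mathbb Q(c)}$ of $\mathbb Q(c)$ such that $$\delta_m(x)^m=\prod_{\Phi_m^*(\alpha)=0}\bigl(x-(f^{\circ m})'(\alpha)\bigr),$$ where $\alpha$ runs over the roots of $\Phi_m^*$ in $\overline{\mathbb Q(c)}$ counted with multiplicity (such a polynomial exists). Then $d+1$ divides $\deg_z\Phi_m^*$, and the polynomial $$d^{\,\deg_z\Phi_m^*/(d+1)}\,\delta_m(x)$$ is an element of $\mathbb Z[dc,x]$ and is monic in $dc$ up to multiplication by $\pm1$; that is, there is a polynomial $\Psi(x,t)\in\mathbb Z[x][t]$, whose leading coefficient as a polynomial in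 $t$ is $1$ or $-1$, such that $d^{\deg_z\Phi_m^*/(d+1)}\delta_m(x)=\Psi(x,dc)$. -/

import Mathlib

open Polynomial

noncomputable section

namespace MultiplierPoly

/-- An algebraic closure of the fraction field of the integral domain `O`. -/
abbrev FracClosure (O : Type*) [CommRing O] [IsDomain O] : Type _ :=
  AlgebraicClosure (FractionRing O)

/-- The `k`-th iterated composition `f ∘ f ∘ ⋯ ∘ f` (with `k = 0` giving `z`). -/
def iter {O : Type*} [CommRing O] (f : O[X]) (k : ℕ) : O[X] :=
  f.comp^[k] X

/-- `Φ` is the `n`-th dynatomic polynomial of `f`: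
`Φ(z) = ∏_{k ∣ n} (f^{∘k}(z) - z)^{μ(n/k)}`, an identity of rational functions in `z`. -/
def IsDynatomic {O : Type*} [CommRing O] [IsDomain O] (f : O[X]) (n : ℕ) (Φ : O[X]) : Prop :=
  algebraMap O[X] (FractionRing O[X]) Φ =
    ∏ k ∈ n.divisors,
      (algebraMap O[X] (FractionRing O[X]) (iter f k - X)) ^ (ArithmeticFunction.moebius (n / k))

/-- The multiplier `ω_n(α) = (f^{∘n})'(α)`. -/
def multiplier {O : Type*} [CommRing O] [IsDomain O] (f : O[X]) (n : ℕ)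
    (α : FracClosure O) : FracClosure O :=
  aeval α (derivative (iter f n))

/-- `δ` is the `n`-th multiplier polynomial of `f`: the monic polynomial `δ(x)` with
`δ(x)^n = ∏_{Φ(α) = 0} (x - ω_n(α))`, where `Φ` is the `n`-th dynatomic polynomial and the product
runs over its roots in the algebraic closure, counted with multiplicity. -/
def IsMultiplierPolynomial {O : Type*} [CommRing O] [IsDomain O] (f : O[X]) (n : ℕ)
    (δ : (FracClosure O)[X]) : Prop :=
  δ.Monic ∧ ∃ Φ : O[X], IsDynatomic f n Φ ∧
    δ ^ n = ((Φ.aroots (FracClosure O)).map fun α => X - C (multiplier f n α)).prod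

/-- The polynomial `f_c(z) = z^{d+1} + c z` over `ℤ[c]`; the inner variable is `c`, the outer
variable is `z`. -/
def family (d : ℕ) : ℤ[X][X] :=
  X ^ (d + 1) + C X * X

/-- The indeterminate `c`, as an element of the algebraic closure of `ℚ(c)`. -/
def cParam : FracClosure ℤ[X] :=
  algebraMap ℤ[X] (FracClosure ℤ[X]) X

/-- For `Ψ(x, t) ∈ ℤ[x][t]` (inner variable `x`, outer variable `t`) and a scalar `a`, the
polynomial `Ψ(x, a)` in `x`. -/
def specialize (Ψ : ℤ[X][X]) (a : FracClosure ℤ[X]) : (FracClosure ℤ[X])[X] :=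
  Ψ.eval₂ (mapRingHom (algebraMap ℤ (FracClosure ℤ[X]))) (C a)

end MultiplierPoly

end

/-! At `c = 0` the polynomial `f^m(z) - z` becomes `z^((d+1)^m) - z`, which is separable, so its
roots over `ℚ(c)` are simple. Hence the roots of the dynatomic polynomial are exactly the points of
exact period `m`, and `δ_m` is the product of `x - λ` over the multipliers `λ` of the `m`-cycles
(`isMultiplierPolynomial_iff`).

Put `t = dc`, `V = c + z^d`, and let `ν` be the number of points of exact period `m`. Then `f'(z) =
(d+1)V - t`, and the values `V` at those points are the roots of a polynomial over `ℤ[t]` with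
leading coefficient `d^(ν/(d+1))` (`exists_valueFactor`, by Gauss's lemma). One factor `d^(ν/(d+1))`
clears the denominators of every product of distinct roots, so the coefficients of `d^(ν/(d+1)) δ_m`
are integral over `ℤ[dc]`. They are Galois invariant, hence lie in `ℚ(c)`, and `ℤ[dc]` is integrally
closed (`exists_lift_coeff`).

Monicity in `t` follows from two facts. Near `c = ∞` each `f'(α)` grows at most like `c`, so the
coefficient of `x^j` has degree at most `ν - jm` in `t` when `j` is at most the number of cycles
(`natDegree_le_of_evalAt_eq`). The constant coefficient is, up to sign and a power of `d+1`, the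
value polynomial at the critical value `V = t/(d+1)`; there it has degree exactly `ν` and leading
coefficient `±1` (`unitLeading_of_evalAt_eq`). -/

noncomputable section

namespace MultiplierPoly

/-! ### Divisor sums, Gauss's lemma and integrality of root products. -/

section Generic

theorem sum_divisors_injective {a b : ℕ → ℕ}
    (h : ∀ m, 1 ≤ m → ∑ k ∈ m.divisors, a k = ∑ k ∈ m.divisors, b k) :
    ∀ m, 1 ≤ m → a m = b m := by
  intro m
  induction m using Nat.strong_induction_on with
  | _ m ih =>
    intro hm
    have h1 := h m hm
    rw [← Nat.cons_self_properDivisors (by omega), Finset.sum_cons, Finset.sum_cons] at h1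
    have h2 : ∑ k ∈ m.properDivisors, a k = ∑ k ∈ m.properDivisors, b k := by
      refine Finset.sum_congr rfl fun k hk => ?_
      rw [Nat.mem_properDivisors] at hk
      exact ih k hk.2 (Nat.pos_of_dvd_of_pos hk.1 hm)
    omega

theorem dvd_of_sum_divisors {a : ℕ → ℕ} {e : ℕ}
    (h : ∀ m, 1 ≤ m → e ∣ ∑ k ∈ m.divisors, a k) : ∀ m, 1 ≤ m → e ∣ a m := by
  intro m
  induction m using Nat.strong_induction_on with
  | _ m ih =>
    intro hm
    have h1 := h m hm
    rw [← Nat.cons_self_properDivisors (by omega), Finset.sum_cons] at h1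
    refine (Nat.dvd_add_left (Finset.dvd_sum fun k hk => ?_)).1 h1
    rw [Nat.mem_properDivisors] at hk
    exact ih k hk.2 (Nat.pos_of_dvd_of_pos hk.1 hm)

theorem isPrimitive_prod {R ι : Type*} [CommRing R] [IsDomain R] [NormalizedGCDMonoid R]
    (s : Finset ι) (g : ι → R[X]) (h : ∀ i ∈ s, (g i).IsPrimitive) :
    (∏ i ∈ s, g i).IsPrimitive := by
  classical
  induction s using Finset.induction_on with
  | empty => simp
  | insert i s hi ih =>
    rw [Finset.prod_insert hi]
    exact (h i (by simp)).mul (ih fun j hj => h j (by simp [hj]))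

theorem dvd_of_map_dvd_map_of_injective {R L : Type*} [CommRing R] [IsDomain R] [NormalizedGCDMonoid R]
    [Field L] {ψ : R →+* L} (hψ : Function.Injective ψ) {p q : R[X]} (hp : p.IsPrimitive)
    (h : p.map ψ ∣ q.map ψ) : p ∣ q := by
  refine hp.dvd_of_fraction_map_dvd_fraction_map (K := FractionRing R) ?_
  rw [← map_dvd_map' (IsFractionRing.lift hψ : FractionRing R →+* L), Polynomial.map_map,
    Polynomial.map_map]
  have : (IsFractionRing.lift hψ : FractionRing R →+* L).comp (algebraMap R (FractionRing R)) = ψ :=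
    RingHom.ext fun x => IsFractionRing.lift_algebraMap hψ x
  rwa [this]

/-- If every `p m` factors over a field as a scalar times `∏_{k ∣ m} G k`, then each `G m` is,
up to the corresponding scalar, defined over the base ring. -/
theorem exists_primitive_factor {R L : Type*} [CommRing R] [IsDomain R] [NormalizedGCDMonoid R]
    [Field L] {ψ : R →+* L} (hψ : Function.Injective ψ) {p : ℕ → R[X]} {G : ℕ → L[X]} {a : ℕ → R}
    (hp : ∀ m, 1 ≤ m → (p m).IsPrimitive) (ha : ∀ m, 1 ≤ m → a m ≠ 0) (hG : ∀ m, (G m).Monic)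
    (h : ∀ m, 1 ≤ m →
      (p m).map ψ = ∏ k ∈ m.divisors, (C (ψ (a k)) * G k)) :
    ∀ m, 1 ≤ m → ∃ g : R[X], g.IsPrimitive ∧ g.map ψ = C (ψ (a m)) * G m := by
  intro m
  induction m using Nat.strong_induction_on with
  | _ m ih =>
    intro hm
    have ih' : ∀ k ∈ m.properDivisors,
        ∃ g : R[X], g.IsPrimitive ∧ g.map ψ = C (ψ (a k)) * G k := fun k hk => by
      rw [Nat.mem_properDivisors] at hk
      exact ih k hk.2 (Nat.pos_of_dvd_of_pos hk.1 hm)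
    choose! g hg1 hg2 using ih'
    have hmap : (∏ k ∈ m.properDivisors, g k).map ψ =
        ∏ k ∈ m.properDivisors, (C (ψ (a k)) * G k) := by
      rw [Polynomial.map_prod]
      exact Finset.prod_congr rfl hg2
    have hpm := h m hm
    rw [← Nat.cons_self_properDivisors (by omega), Finset.prod_cons, ← hmap] at hpm
    -- Gauss's lemma: the factors already descended have a primitive product, so divisibility over
    -- `L` descends to `R`, and the cofactor is the new factor.
    obtain ⟨u, hu⟩ : ∏ k ∈ m.properDivisors, g k ∣ p m :=
      dvd_of_map_dvd_map_of_injective hψ (isPrimitive_prod _ _ hg1) ⟨_, hpm.trans (mul_comm _ _)⟩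
    refine ⟨u, isPrimitive_of_dvd (hp m hm) ⟨_, hu.trans (mul_comm _ _)⟩, ?_⟩
    have hne : (∏ k ∈ m.properDivisors, g k).map ψ ≠ 0 := by
      rw [hmap]
      refine Finset.prod_ne_zero_iff.2 fun k hk => mul_ne_zero ?_ (hG k).ne_zero
      rw [Nat.mem_properDivisors] at hk
      rw [Ne, C_eq_zero, map_eq_zero_iff ψ hψ]
      exact ha k (Nat.pos_of_dvd_of_pos hk.1 hm)
    refine mul_left_cancel₀ hne ?_
    rw [← Polynomial.map_mul, ← hu, hpm, mul_comm]

theorem monic_eq_of_pow_eq {K : Type*} [Field K] [IsAlgClosed K] {n : ℕ} (hn : n ≠ 0)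
    {p q : K[X]} (hp : p.Monic) (hq : q.Monic) (h : p ^ n = q ^ n) : p = q := by
  have h1 : n • p.roots = n • q.roots := by rw [← roots_pow, ← roots_pow, h]
  have h2 : p.roots = q.roots := by
    classical
    ext x
    have := congrArg (Multiset.count x) h1
    rw [Multiset.count_nsmul, Multiset.count_nsmul] at this
    exact Nat.eq_of_mul_eq_mul_left (Nat.pos_of_ne_zero hn) this
  rw [(IsAlgClosed.splits p).eq_prod_roots_of_monic hp,
    (IsAlgClosed.splits q).eq_prod_roots_of_monic hq, h2]

section Integral

variable {R L : Type*} [CommRing R] [Field L] [Algebra R L]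

/-- Dividing a polynomial with integral coefficients by a linear factor keeps them integral. -/
theorem isIntegral_coeff_of_X_sub_C_mul (v : L) : ∀ (n : ℕ) (q : L[X]), q.natDegree ≤ n →
    (∀ i, IsIntegral R (((X - C v) * q).coeff i)) → ∀ i, IsIntegral R (q.coeff i) := by
  -- `v` is a root of `(X - v) q`, whose leading coefficient is that of `q`; a root times the
  -- leading coefficient is integral.
  have key : ∀ q : L[X], q ≠ 0 → (∀ i, IsIntegral R (((X - C v) * q).coeff i)) →
      IsIntegral R q.leadingCoeff ∧ IsIntegral R (q.leadingCoeff * v) := by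
    intro q hq0 hq
    have hlc : ((X - C v) * q).leadingCoeff = q.leadingCoeff := by
      rw [leadingCoeff_mul, leadingCoeff_X_sub_C, one_mul]
    refine ⟨hlc ▸ hq _, ?_⟩
    set A := integralClosure R L
    have hl : (X - C v) * q ∈ lifts (algebraMap A L) := by
      rw [lifts_iff_coeff_lifts]
      exact fun i => ⟨⟨_, hq i⟩, rfl⟩
    obtain ⟨P, hP⟩ := hl
    have hinj : Function.Injective (algebraMap A L) := Subtype.val_injective
    have h0 : aeval v P = 0 := by
      rw [aeval_def, ← eval_map]
      change eval v ((mapRingHom (algebraMap A L)) P) = 0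
      rw [hP]; simp
    have h1 := isIntegral_leadingCoeff_smul P v h0
    have h2 : P.leadingCoeff • v = q.leadingCoeff * v := by
      rw [Algebra.smul_def, ← leadingCoeff_map_of_injective hinj]
      change ((mapRingHom (algebraMap A L)) P).leadingCoeff * v = _
      rw [hP, hlc]
    rw [h2] at h1
    exact isIntegral_trans _ h1
  intro n
  induction n with
  | zero =>
    intro q hdeg hq i
    by_cases hq0 : q = 0
    · simp [hq0, isIntegral_zero]
    · have := (key q hq0 hq).1
      rcases Nat.eq_zero_or_pos i with rfl | hi
      · rwa [leadingCoeff, Nat.le_zero.1 hdeg] at this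
      · rw [coeff_eq_zero_of_natDegree_lt (by omega)]; exact isIntegral_zero
  | succ n ih =>
    intro q hdeg hq i
    by_cases hq0 : q = 0
    · simp [hq0, isIntegral_zero]
    obtain ⟨h1, h2⟩ := key q hq0 hq
    have hlead : ∀ j, IsIntegral R ((C q.leadingCoeff * X ^ q.natDegree).coeff j) := by
      intro j
      rw [coeff_C_mul_X_pow]
      split_ifs
      exacts [h1, isIntegral_zero]
    have herase : q.eraseLead = q - C q.leadingCoeff * X ^ q.natDegree := by
      rw [self_sub_C_mul_X_pow]
    -- Removing the leading term of `q` changes `(X - v) q` only by terms with coefficients `lc` and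
    -- `lc * v`, both integral by `key`.
    have := ih q.eraseLead ((eraseLead_natDegree_le q).trans (by omega)) (by
      intro j
      rw [herase, mul_sub, coeff_sub]
      refine (hq j).sub ?_
      rw [sub_mul, coeff_sub]
      refine IsIntegral.sub ?_ ?_
      · rw [show X * (C q.leadingCoeff * X ^ q.natDegree) =
          C q.leadingCoeff * X ^ (q.natDegree + 1) by ring, coeff_C_mul_X_pow]
        split_ifs
        exacts [h1, isIntegral_zero]
      · rw [show C v * (C q.leadingCoeff * X ^ q.natDegree) =
          C (q.leadingCoeff * v) * X ^ q.natDegree by rw [C_mul]; ring, coeff_C_mul_X_pow]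
        split_ifs
        exacts [h2, isIntegral_zero]) i
    have h3 : q.coeff i = q.eraseLead.coeff i + (C q.leadingCoeff * X ^ q.natDegree).coeff i := by
      rw [herase, coeff_sub]; ring
    rw [h3]
    exact this.add (hlead i)

/-- Divide out the linear factors outside `t` one at a time; the constant coefficient that remains
is `±a ∏ v j`. -/
theorem isIntegral_mul_prod_of_subset {ι : Type*} [DecidableEq ι] {a : L} {v : ι → L}
    {s t : Finset ι} (hts : t ⊆ s)
    (h : ∀ i, IsIntegral R ((C a * ∏ j ∈ s, (X - C (v j))).coeff i)) :
    IsIntegral R (a * ∏ j ∈ t, v j) := by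
  have h1 : ∀ u : Finset ι, Disjoint u t →
      (∀ i, IsIntegral R ((C a * ∏ j ∈ u ∪ t, (X - C (v j))).coeff i)) →
      ∀ i, IsIntegral R ((C a * ∏ j ∈ t, (X - C (v j))).coeff i) := by
    intro u
    induction u using Finset.induction_on with
    | empty => intro _ h; simpa using h
    | insert j u hj ih =>
      intro hd h
      rw [Finset.disjoint_insert_left] at hd
      refine ih hd.2 (isIntegral_coeff_of_X_sub_C_mul (v j) _ _ le_rfl ?_)
      rw [Finset.insert_union, Finset.prod_insert (by simp [hj, hd.1])] at h
      intro i
      rw [mul_left_comm]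
      exact h i
  have h2 := h1 (s \ t) Finset.sdiff_disjoint (by rwa [Finset.sdiff_union_of_subset hts]) 0
  rw [coeff_zero_eq_eval_zero, eval_mul, eval_C, eval_prod] at h2
  simp only [eval_sub, eval_X, eval_C, zero_sub] at h2
  rw [Finset.prod_neg] at h2
  rcases neg_one_pow_eq_or L t.card with hc | hc
  · simpa [hc] using h2
  · simpa [hc] using h2.neg

/-- Expanding the product gives subset products of the `v j`, each needing `a` only once. It is
applied with `e * v j + b = (d+1) V - dc`, the derivative at a periodic point. -/
theorem isIntegral_mul_prod_affine {ι : Type*} [DecidableEq ι] {a e b : L} {v : ι → L}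
    {s t : Finset ι} (hts : t ⊆ s) (he : IsIntegral R e) (hb : IsIntegral R b)
    (h : ∀ i, IsIntegral R ((C a * ∏ j ∈ s, (X - C (v j))).coeff i)) :
    IsIntegral R (a * ∏ j ∈ t, (e * v j + b)) := by
  rw [Finset.prod_add, Finset.mul_sum]
  refine IsIntegral.sum _ fun u hu => ?_
  rw [Finset.mem_powerset] at hu
  rw [Finset.prod_mul_distrib, Finset.prod_const, Finset.prod_const,
    show a * ((e ^ u.card * ∏ j ∈ u, v j) * b ^ (t \ u).card) =
      e ^ u.card * b ^ (t \ u).card * (a * ∏ j ∈ u, v j) by ring]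
  exact ((he.pow _).mul (hb.pow _)).mul (isIntegral_mul_prod_of_subset (hu.trans hts) h)

/-- Coefficients of `a ∏ (X - l_i)` are sums of terms `± a ∏_{i ∈ u} l_i`. -/
theorem isIntegral_coeff_of_subprods {ι : Type*} [DecidableEq ι] {a : L} {l : ι → L}
    {s : Finset ι} (j : ℕ)
    (h : ∀ u ⊆ s, u.card + j = s.card → IsIntegral R (a * ∏ i ∈ u, l i)) :
    IsIntegral R (a * (∏ i ∈ s, (X - C (l i))).coeff j) := by
  have hsum : ∏ i ∈ s, (X - C (l i)) =
      ∑ u ∈ s.powerset, C ((-1) ^ u.card * ∏ i ∈ u, l i) * X ^ (s \ u).card := by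
    have : ∏ i ∈ s, (X - C (l i)) = ∏ i ∈ s, (C (-l i) + X) :=
      Finset.prod_congr rfl fun i _ => by rw [C_neg]; ring
    rw [this, Finset.prod_add]
    refine Finset.sum_congr rfl fun u _ => ?_
    rw [Finset.prod_const, ← map_prod, Finset.prod_neg]
  rw [hsum, finsetSum_coeff, Finset.mul_sum]
  refine IsIntegral.sum _ fun u hu => ?_
  rw [Finset.mem_powerset] at hu
  rw [coeff_C_mul_X_pow]
  have hcard := Finset.card_sdiff_add_card_eq_card hu
  split_ifs with hj
  · have := h u hu (by omega)
    rcases neg_one_pow_eq_or L u.card with hc | hc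
    · simpa [hc] using this
    · simpa [hc] using this.neg
  · simpa using isIntegral_zero

theorem mem_range_of_isIntegral [IsDomain R] [IsIntegrallyClosed R]
    (hinj : Function.Injective (algebraMap R L)) {x : L} {a b : R}
    (h : algebraMap R L a / algebraMap R L b = x) (hx : IsIntegral R x) :
    x ∈ (algebraMap R L).range := by
  let j : FractionRing R →ₐ[R] L := IsFractionRing.liftAlgHom (g := Algebra.ofId R L) hinj
  set y : FractionRing R := algebraMap R _ a / algebraMap R _ b
  have hy : j y = x := by
    rw [← h, map_div₀, AlgHom.commutes, AlgHom.commutes]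
  rw [← hy, isIntegral_algHom_iff j j.toRingHom.injective] at hx
  obtain ⟨r, hr⟩ := IsIntegrallyClosed.isIntegral_iff.1 hx
  exact ⟨r, by rw [← hy, ← hr, AlgHom.commutes]⟩

end Integral

theorem mem_subring_of_isIntegral {L : Type*} [Field L] {A : Subring L} [IsIntegrallyClosed A]
    {x : L} (h : x ∈ Subfield.closure (A : Set L)) (hx : IsIntegral A x) : x ∈ A := by
  rw [Subfield.mem_closure_iff, Subring.closure_eq] at h
  obtain ⟨a, ha, b, hb, hab⟩ := h
  obtain ⟨r, hr⟩ := mem_range_of_isIntegral (R := A) Subtype.val_injective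
    (a := ⟨a, ha⟩) (b := ⟨b, hb⟩) hab hx
  exact hr ▸ r.2

end Generic

/-- The self-map `α ↦ α^{d+1} + c α` of the algebraic closure of `ℚ(c)`. -/
def familyMap (d : ℕ) (α : FracClosure ℤ[X]) : FracClosure ℤ[X] :=
  α ^ (d + 1) + cParam * α

/-- The polynomial `f^{∘m}(z) - z`. -/
def periodPoly (d m : ℕ) : ℤ[X][X] :=
  iter (family d) m - X

theorem algebraMap_fracClosure_injective :
    Function.Injective (algebraMap ℤ[X] (FracClosure ℤ[X])) := by
  rw [IsScalarTower.algebraMap_eq ℤ[X] (FractionRing ℤ[X]) (FracClosure ℤ[X])]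
  exact (algebraMap (FractionRing ℤ[X]) (FracClosure ℤ[X])).injective.comp
    (IsFractionRing.injective ℤ[X] (FractionRing ℤ[X]))

instance : Module.IsTorsionFree ℤ[X] (FracClosure ℤ[X]) :=
  Module.isTorsionFree_iff_algebraMap_injective.2 algebraMap_fracClosure_injective

theorem cParam_ne_zero : cParam ≠ 0 := by
  rw [cParam, Ne, map_eq_zero_iff _ algebraMap_fracClosure_injective]
  exact X_ne_zero

/-! ### Iterates of the family and simplicity of the periodic points. -/

section Iterates

variable {d m : ℕ}

theorem iter_zero' : iter (family d) 0 = X := rfl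

theorem iter_succ' (k : ℕ) : iter (family d) (k + 1) = (family d).comp (iter (family d) k) := by
  rw [iter, Function.iterate_succ_apply']
  rfl

theorem aeval_iter (α : FracClosure ℤ[X]) (k : ℕ) :
    aeval α (iter (family d) k) = (familyMap d)^[k] α := by
  induction k with
  | zero => simp [iter_zero']
  | succ k ih =>
    rw [iter_succ', aeval_comp, ih, Function.iterate_succ_apply']
    simp [family, familyMap, cParam]

theorem family_monic_natDegree (hd : 1 ≤ d) :
    (family d).Monic ∧ (family d).natDegree = d + 1 := by
  have h : (C X * X : ℤ[X][X]).degree < ((d + 1 : ℕ) : WithBot ℕ) :=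
    (degree_C_mul_X_le _).trans_lt (by exact_mod_cast (by omega : 1 < d + 1))
  refine ⟨monic_X_pow_add h, ?_⟩
  rw [family, natDegree_eq_of_degree_eq_some]
  rw [degree_add_eq_left_of_degree_lt, degree_X_pow]
  rwa [degree_X_pow]

theorem iter_monic_natDegree (hd : 1 ≤ d) (k : ℕ) :
    (iter (family d) k).Monic ∧ (iter (family d) k).natDegree = (d + 1) ^ k := by
  induction k with
  | zero => simp [iter_zero', monic_X]
  | succ k ih =>
    rw [iter_succ']
    obtain ⟨h1, h2⟩ := family_monic_natDegree hd
    refine ⟨h1.comp ih.1 ?_, ?_⟩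
    · rw [ih.2]; positivity
    · rw [natDegree_comp, h2, ih.2, pow_succ']

theorem periodPoly_monic_natDegree (hd : 1 ≤ d) (hm : 1 ≤ m) :
    (periodPoly d m).Monic ∧ (periodPoly d m).natDegree = (d + 1) ^ m := by
  obtain ⟨h1, h2⟩ := iter_monic_natDegree hd m
  have hlt : 1 < (d + 1) ^ m := Nat.one_lt_pow (by omega) (by omega)
  have h : (X : ℤ[X][X]).degree < (iter (family d) m).degree := by
    rw [degree_eq_natDegree h1.ne_zero, h2, degree_X]
    exact_mod_cast hlt
  refine ⟨h1.sub_of_left h, ?_⟩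
  rw [periodPoly, natDegree_sub_eq_left_of_natDegree_lt, h2]
  rwa [h2, natDegree_X]

theorem map_iter_eval_zero (k : ℕ) :
    (iter (family d) k).map (evalRingHom (0 : ℤ)) = X ^ (d + 1) ^ k := by
  induction k with
  | zero => simp [iter_zero']
  | succ k ih =>
    rw [iter_succ', map_comp, ih]
    simp [family, ← pow_mul, pow_succ, mul_add, pow_add]

/-- At `c = 0` the polynomial `f^{∘m}(z) - z` becomes `z^{(d+1)^m} - z`, which is separable. -/
theorem isCoprime_specialization {D : ℕ} (hD : 2 ≤ D) :
    IsCoprime (X ^ D - X : ℚ[X]) (derivative (X ^ D - X : ℚ[X])) := by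
  have h1 : (X ^ D - X : ℚ[X]) = X * (X ^ (D - 1) - C 1) := by
    obtain ⟨e, rfl⟩ : ∃ e, D = e + 1 := ⟨D - 1, by omega⟩
    simp [pow_succ]; ring
  change Separable _
  rw [h1]
  refine Separable.mul separable_X (separable_X_pow_sub_C _ ?_ one_ne_zero) ?_
  · exact_mod_cast (by omega : D - 1 ≠ 0)
  · refine ⟨X ^ (D - 2), -1, ?_⟩
    rw [← pow_succ, show D - 2 + 1 = D - 1 by omega]
    simp

theorem aeval_periodPoly (α : FracClosure ℤ[X]) (k : ℕ) :
    aeval α (periodPoly d k) = (familyMap d)^[k] α - α := by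
  rw [periodPoly, map_sub, aeval_iter, aeval_X]

/-- At a multiple root, the minimal polynomial over `ℤ[c]` would divide both `f^m(z) - z` and its
derivative. Being monic, it keeps its positive degree at `c = 0`, where these two are coprime. -/
theorem aeval_derivative_periodPoly_ne_zero (hd : 1 ≤ d) (hm : 1 ≤ m) {α : FracClosure ℤ[X]}
    (h : aeval α (periodPoly d m) = 0) : aeval α (derivative (periodPoly d m)) ≠ 0 := by
  intro h'
  have hint : IsIntegral ℤ[X] α :=
    ⟨periodPoly d m, (periodPoly_monic_natDegree hd hm).1, by rwa [aeval_def] at h⟩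
  set μ := minpoly ℤ[X] α
  have hμ : μ.Monic := minpoly.monic hint
  set φ : ℤ[X] →+* ℚ := (Int.castRingHom ℚ).comp (evalRingHom 0)
  have hmap : (periodPoly d m).map φ = X ^ (d + 1) ^ m - X := by
    rw [← Polynomial.map_map, periodPoly, Polynomial.map_sub, map_iter_eval_zero]
    simp
  have h1 : μ.map φ ∣ X ^ (d + 1) ^ m - X := by
    rw [← hmap]
    exact Polynomial.map_dvd φ (minpoly.isIntegrallyClosed_dvd hint h)
  have h2 : μ.map φ ∣ derivative (X ^ (d + 1) ^ m - X : ℚ[X]) := by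
    rw [← hmap, derivative_map]
    exact Polynomial.map_dvd φ (minpoly.isIntegrallyClosed_dvd hint h')
  have hu : IsUnit (μ.map φ) :=
    (isCoprime_specialization (Nat.one_lt_pow (by omega) (by omega))).isUnit_of_dvd' h1 h2
  have hpos : 0 < μ.natDegree := minpoly.natDegree_pos hint
  rw [(hμ.map φ).isUnit_iff] at hu
  have := hμ.natDegree_map φ
  rw [hu, natDegree_one] at this
  omega

theorem nodup_aroots_periodPoly (hd : 1 ≤ d) (hm : 1 ≤ m) :
    ((periodPoly d m).aroots (FracClosure ℤ[X])).Nodup := by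
  classical
  rw [Multiset.nodup_iff_count_le_one]
  intro α
  rw [count_roots]
  by_contra! hlt
  have hne : (periodPoly d m).map (algebraMap ℤ[X] (FracClosure ℤ[X])) ≠ 0 :=
    ((periodPoly_monic_natDegree hd hm).1.map _).ne_zero
  rw [one_lt_rootMultiplicity_iff_isRoot hne, derivative_map] at hlt
  refine aeval_derivative_periodPoly_ne_zero hd hm (α := α) ?_ ?_
  · rw [aeval_def, ← eval_map]; exact hlt.1
  · rw [aeval_def, ← eval_map]; exact hlt.2

end Iterates

/-! ### Points of exact period and their number. -/

section Periodic

open scoped Classical in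
/-- The points fixed by the `m`-th iterate. -/
def fixedPts (d m : ℕ) : Finset (FracClosure ℤ[X]) :=
  ((periodPoly d m).aroots (FracClosure ℤ[X])).toFinset

open scoped Classical in
/-- The points of exact period `m`. -/
def exactPts (d m : ℕ) : Finset (FracClosure ℤ[X]) :=
  (fixedPts d m).filter fun α => Function.minimalPeriod (familyMap d) α = m

variable {d m : ℕ}

theorem mem_fixedPts (hd : 1 ≤ d) (hm : 1 ≤ m) {α : FracClosure ℤ[X]} :
    α ∈ fixedPts d m ↔ (familyMap d)^[m] α = α := by
  classical
  rw [fixedPts, Multiset.mem_toFinset, mem_aroots', aeval_periodPoly, sub_eq_zero]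
  exact and_iff_right ((periodPoly_monic_natDegree hd hm).1.map _).ne_zero

theorem mem_exactPts (hd : 1 ≤ d) (hm : 1 ≤ m) {α : FracClosure ℤ[X]} :
    α ∈ exactPts d m ↔ Function.minimalPeriod (familyMap d) α = m := by
  rw [exactPts, Finset.mem_filter, mem_fixedPts hd hm]
  refine and_iff_right_of_imp fun h => ?_
  have := Function.isPeriodicPt_minimalPeriod (familyMap d) α
  rwa [h] at this

theorem map_periodPoly (hd : 1 ≤ d) (hm : 1 ≤ m) :
    (periodPoly d m).map (algebraMap ℤ[X] (FracClosure ℤ[X])) =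
      ∏ α ∈ fixedPts d m, (X - C α) := by
  classical
  rw [(IsAlgClosed.splits _).eq_prod_roots_of_monic ((periodPoly_monic_natDegree hd hm).1.map _),
    Finset.prod, fixedPts, Multiset.toFinset_val, (nodup_aroots_periodPoly hd hm).dedup]

theorem card_fixedPts (hd : 1 ≤ d) (hm : 1 ≤ m) : (fixedPts d m).card = (d + 1) ^ m := by
  have h := (periodPoly_monic_natDegree hd hm).1.natDegree_map
    (algebraMap ℤ[X] (FracClosure ℤ[X]))
  rw [map_periodPoly hd hm, natDegree_finsetProd_X_sub_C_eq_card,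
    (periodPoly_monic_natDegree hd hm).2] at h
  exact h

theorem prod_divisors_exactPts {M : Type*} [CommMonoid M] (hd : 1 ≤ d) (hm : 1 ≤ m)
    (h : FracClosure ℤ[X] → M) :
    ∏ k ∈ m.divisors, ∏ α ∈ exactPts d k, h α = ∏ α ∈ fixedPts d m, h α := by
  classical
  rw [← Finset.prod_fiberwise_of_maps_to (s := fixedPts d m) (t := m.divisors)
    (g := Function.minimalPeriod (familyMap d))]
  · refine Finset.prod_congr rfl fun k hk => Finset.prod_congr ?_ fun _ _ => rfl
    have hk1 := Nat.pos_of_mem_divisors hk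
    ext α
    rw [mem_exactPts hd hk1, Finset.mem_filter, mem_fixedPts hd hm]
    refine (and_iff_right_of_imp fun h => ?_).symm
    refine Function.isPeriodicPt_iff_minimalPeriod_dvd.2 ?_
    rw [h]
    exact Nat.dvd_of_mem_divisors hk
  · intro α hα
    rw [mem_fixedPts hd hm] at hα
    rw [Nat.mem_divisors]
    exact ⟨Function.isPeriodicPt_iff_minimalPeriod_dvd.1 hα, by omega⟩

theorem sum_card_exactPts (hd : 1 ≤ d) (hm : 1 ≤ m) :
    ∑ k ∈ m.divisors, (exactPts d k).card = (d + 1) ^ m := by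
  rw [← card_fixedPts hd hm]
  have := prod_divisors_exactPts (M := Multiplicative ℕ) hd hm fun _ => Multiplicative.ofAdd 1
  simp only [Finset.prod_const, ← ofAdd_nsmul, smul_eq_mul, mul_one, ← ofAdd_sum] at this
  exact Multiplicative.ofAdd.injective this

theorem succ_dvd_card_exactPts (hd : 1 ≤ d) (hm : 1 ≤ m) : d + 1 ∣ (exactPts d m).card :=
  dvd_of_sum_divisors (a := fun k => (exactPts d k).card) (fun m hm => by
    rw [sum_card_exactPts hd hm]
    exact dvd_pow_self _ (by omega)) m hm

theorem sum_card_exactPts_div (hd : 1 ≤ d) (hm : 1 ≤ m) :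
    ∑ k ∈ m.divisors, (exactPts d k).card / (d + 1) = (d + 1) ^ (m - 1) := by
  refine Nat.eq_of_mul_eq_mul_left (Nat.succ_pos d) ?_
  rw [Finset.mul_sum, ← Nat.succ_eq_add_one, ← pow_succ', Nat.sub_add_cancel hm,
    Nat.succ_eq_add_one, ← sum_card_exactPts hd hm]
  exact Finset.sum_congr rfl fun k hk =>
    Nat.mul_div_cancel' (succ_dvd_card_exactPts hd (Nat.pos_of_mem_divisors hk))

end Periodic

/-! ### The dynatomic polynomial as the product over points of exact period. -/

section Dynatomic

variable {d m : ℕ}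

theorem periodPoly_ne_zero (hd : 1 ≤ d) (hm : 1 ≤ m) : periodPoly d m ≠ 0 :=
  (periodPoly_monic_natDegree hd hm).1.ne_zero

theorem exists_dynatomic_factor (hd : 1 ≤ d) : ∀ m, 1 ≤ m → ∃ Φ : ℤ[X][X],
    Φ.map (algebraMap ℤ[X] (FracClosure ℤ[X])) = ∏ α ∈ exactPts d m, (X - C α) := by
  intro m hm
  obtain ⟨g, -, hg⟩ := exists_primitive_factor (ψ := algebraMap ℤ[X] (FracClosure ℤ[X]))
    (p := periodPoly d) (G := fun k => ∏ α ∈ exactPts d k, (X - C α)) (a := fun _ => 1)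
    algebraMap_fracClosure_injective (fun m hm => (periodPoly_monic_natDegree hd hm).1.isPrimitive)
    (fun _ _ => one_ne_zero) (fun k => monic_prod_X_sub_C _ _) (fun m hm => by
      simp only [map_one, one_mul]
      rw [prod_divisors_exactPts hd hm (fun α => X - C α), map_periodPoly hd hm]) m hm
  exact ⟨g, by simpa using hg⟩

/-- Multiplicative Möbius inversion in the fraction field of `ℤ[c][z]`, applied to the factorisation
of `f^n(z) - z` over the divisors of `n`. -/
theorem isDynatomic_of_map_eq (hd : 1 ≤ d) (hm : 1 ≤ m) {Φ : ℤ[X][X]}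
    (h : Φ.map (algebraMap ℤ[X] (FracClosure ℤ[X])) = ∏ α ∈ exactPts d m, (X - C α)) :
    IsDynatomic (family d) m Φ := by
  choose! Ξ hΞ using exists_dynatomic_factor hd
  have hinj := IsFractionRing.injective ℤ[X][X] (FractionRing ℤ[X][X])
  have hmapinj : Function.Injective
      (Polynomial.map (algebraMap ℤ[X] (FracClosure ℤ[X]))) :=
    map_injective _ algebraMap_fracClosure_injective
  have hprod : ∀ n, 0 < n → ∏ k ∈ n.divisors, Ξ k = periodPoly d n := fun n hn => by
    refine hmapinj ?_
    rw [Polynomial.map_prod, map_periodPoly hd hn, ← prod_divisors_exactPts hd hn]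
    exact Finset.prod_congr rfl fun k hk => hΞ k (Nat.pos_of_mem_divisors hk)
  have hne : ∀ n, 0 < n → algebraMap ℤ[X][X] (FractionRing ℤ[X][X]) (Ξ n) ≠ 0 := fun n hn => by
    rw [Ne, map_eq_zero_iff _ hinj]
    intro h0
    have := hΞ n hn
    rw [h0, Polynomial.map_zero] at this
    exact (monic_prod_X_sub_C _ _).ne_zero this.symm
  have hΦ : Φ = Ξ m := hmapinj (h.trans (hΞ m hm).symm)
  have hne' : ∀ n, 0 < n →
      algebraMap ℤ[X][X] (FractionRing ℤ[X][X]) (periodPoly d n) ≠ 0 := fun n hn => by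
    rw [Ne, map_eq_zero_iff _ hinj]
    exact periodPoly_ne_zero hd hn
  have := (ArithmeticFunction.prod_eq_iff_prod_pow_moebius_eq_of_nonzero hne hne').1
    (fun n hn => by rw [← map_prod, hprod n hn]) m hm
  rw [Nat.prod_divisorsAntidiagonal' (f := fun a b =>
    algebraMap ℤ[X][X] (FractionRing ℤ[X][X]) (periodPoly d b) ^ ArithmeticFunction.moebius a)]
    at this
  rw [IsDynatomic, hΦ, ← this]
  rfl

theorem isDynatomic_unique {f Φ Ψ : ℤ[X][X]} (h : IsDynatomic f m Φ) (h' : IsDynatomic f m Ψ) :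
    Φ = Ψ :=
  IsFractionRing.injective ℤ[X][X] (FractionRing ℤ[X][X])
    (Eq.trans (Eq.trans h rfl) (Eq.symm h'))

theorem isDynatomic_iff (hd : 1 ≤ d) (hm : 1 ≤ m) {Φ : ℤ[X][X]} :
    IsDynatomic (family d) m Φ ↔
      Φ.map (algebraMap ℤ[X] (FracClosure ℤ[X])) = ∏ α ∈ exactPts d m, (X - C α) := by
  refine ⟨fun h => ?_, isDynatomic_of_map_eq hd hm⟩
  obtain ⟨Ξ, hΞ⟩ := exists_dynatomic_factor hd m hm
  rwa [isDynatomic_unique h (isDynatomic_of_map_eq hd hm hΞ)]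

theorem natDegree_of_isDynatomic (hd : 1 ≤ d) (hm : 1 ≤ m) {Φ : ℤ[X][X]}
    (h : IsDynatomic (family d) m Φ) : Φ.natDegree = (exactPts d m).card := by
  rw [isDynatomic_iff hd hm] at h
  rw [← natDegree_map_eq_of_injective algebraMap_fracClosure_injective, h,
    natDegree_finsetProd_X_sub_C_eq_card]

theorem aroots_of_isDynatomic (hd : 1 ≤ d) (hm : 1 ≤ m) {Φ : ℤ[X][X]}
    (h : IsDynatomic (family d) m Φ) : Φ.aroots (FracClosure ℤ[X]) = (exactPts d m).val := by
  rw [isDynatomic_iff hd hm] at h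
  rw [aroots, h, roots_prod_X_sub_C]

end Dynatomic

/-! ### Cycles, their multipliers and Galois invariance. -/

section Cycles

/-- The derivative `(d+1) α^d + c` of the family at `α`. -/
def familyDeriv (d : ℕ) (α : FracClosure ℤ[X]) : FracClosure ℤ[X] :=
  (d + 1) * α ^ d + cParam

open scoped Classical in
/-- The first `m` points of the forward orbit of `α`. -/
def orbitFinset (d m : ℕ) (α : FracClosure ℤ[X]) : Finset (FracClosure ℤ[X]) :=
  (Finset.range m).image fun i => (familyMap d)^[i] α

open scoped Classical in
/-- The cycles of exact period `m`. -/
def cycles (d m : ℕ) : Finset (Finset (FracClosure ℤ[X])) :=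
  (exactPts d m).image (orbitFinset d m)

/-- The multiplier of a cycle. -/
def cycleMultiplier (d : ℕ) (O : Finset (FracClosure ℤ[X])) : FracClosure ℤ[X] :=
  ∏ α ∈ O, familyDeriv d α

/-- The product of `x - λ` over the multipliers `λ` of the cycles of exact period `m`. -/
def cyclePoly (d m : ℕ) : (FracClosure ℤ[X])[X] :=
  ∏ O ∈ cycles d m, (X - C (cycleMultiplier d O))

variable {d m : ℕ}

theorem aeval_derivative_family (α : FracClosure ℤ[X]) :
    aeval α (derivative (family d)) = familyDeriv d α := by
  simp [family, familyDeriv, cParam]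

theorem multiplier_eq_prod (α : FracClosure ℤ[X]) (k : ℕ) :
    multiplier (family d) k α = ∏ i ∈ Finset.range k, familyDeriv d ((familyMap d)^[i] α) := by
  induction k with
  | zero => simp [multiplier, iter_zero']
  | succ k ih =>
    rw [multiplier] at ih
    rw [multiplier, iter_succ', derivative_comp, map_mul, ih, aeval_comp, aeval_iter,
      aeval_derivative_family, Finset.prod_range_succ]

theorem injOn_iterate {α : FracClosure ℤ[X]}
    (h : Function.minimalPeriod (familyMap d) α = m) :
    Set.InjOn (fun i => (familyMap d)^[i] α) (Finset.range m : Set ℕ) := by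
  have := Function.iterate_injOn_Iio_minimalPeriod (f := familyMap d) (x := α)
  rw [h] at this
  intro i hi j hj hij
  exact this (by simpa using hi) (by simpa using hj) hij

theorem card_orbitFinset {α : FracClosure ℤ[X]}
    (h : Function.minimalPeriod (familyMap d) α = m) : (orbitFinset d m α).card = m := by
  classical
  rw [orbitFinset, Finset.card_image_of_injOn (injOn_iterate h), Finset.card_range]

theorem prod_orbitFinset {α : FracClosure ℤ[X]}
    (h : Function.minimalPeriod (familyMap d) α = m) :
    cycleMultiplier d (orbitFinset d m α) = multiplier (family d) m α := by
  classical
  rw [cycleMultiplier, orbitFinset, Finset.prod_image (injOn_iterate h), multiplier_eq_prod]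

theorem minimalPeriod_of_mem_orbitFinset (hm : 1 ≤ m) {α β : FracClosure ℤ[X]}
    (h : Function.minimalPeriod (familyMap d) α = m) (hβ : β ∈ orbitFinset d m α) :
    Function.minimalPeriod (familyMap d) β = m := by
  classical
  rw [orbitFinset, Finset.mem_image] at hβ
  obtain ⟨i, -, rfl⟩ := hβ
  rw [Function.minimalPeriod_apply_iterate, h]
  exact Function.minimalPeriod_pos_iff_mem_periodicPts.1 (by omega)

theorem mem_orbitFinset_self (hm : 1 ≤ m) (α : FracClosure ℤ[X]) : α ∈ orbitFinset d m α := by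
  classical
  rw [orbitFinset, Finset.mem_image]
  exact ⟨0, Finset.mem_range.2 hm, rfl⟩

theorem orbitFinset_eq_of_mem (hm : 1 ≤ m) {α β : FracClosure ℤ[X]}
    (h : Function.minimalPeriod (familyMap d) α = m) (hβ : β ∈ orbitFinset d m α) :
    orbitFinset d m β = orbitFinset d m α := by
  classical
  refine Finset.eq_of_subset_of_card_le (fun γ hγ => ?_) ?_
  · rw [orbitFinset, Finset.mem_image] at hβ hγ ⊢
    obtain ⟨i, -, rfl⟩ := hβ
    obtain ⟨j, -, rfl⟩ := hγ
    refine ⟨(j + i) % m, Finset.mem_range.2 (Nat.mod_lt _ hm), ?_⟩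
    have := Function.iterate_mod_minimalPeriod_eq (f := familyMap d) (x := α) (n := j + i)
    rw [h] at this
    rw [this, Function.iterate_add_apply]
  · rw [card_orbitFinset h, card_orbitFinset (minimalPeriod_of_mem_orbitFinset hm h hβ)]

open scoped Classical in
theorem filter_orbitFinset_eq (hd : 1 ≤ d) (hm : 1 ≤ m) {O : Finset (FracClosure ℤ[X])}
    (hO : O ∈ cycles d m) : (exactPts d m).filter (fun α => orbitFinset d m α = O) = O := by
  rw [cycles, Finset.mem_image] at hO
  obtain ⟨α, hα, rfl⟩ := hO
  rw [mem_exactPts hd hm] at hα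
  ext β
  rw [Finset.mem_filter, mem_exactPts hd hm]
  refine ⟨fun h => h.2 ▸ mem_orbitFinset_self hm β, fun h => ?_⟩
  exact ⟨minimalPeriod_of_mem_orbitFinset hm hα h, orbitFinset_eq_of_mem hm hα h⟩

theorem card_of_mem_cycles (hd : 1 ≤ d) (hm : 1 ≤ m) {O : Finset (FracClosure ℤ[X])}
    (hO : O ∈ cycles d m) : O.card = m := by
  classical
  rw [cycles, Finset.mem_image] at hO
  obtain ⟨α, hα, rfl⟩ := hO
  exact card_orbitFinset ((mem_exactPts hd hm).1 hα)

theorem subset_of_mem_cycles (hd : 1 ≤ d) (hm : 1 ≤ m) {O : Finset (FracClosure ℤ[X])}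
    (hO : O ∈ cycles d m) : O ⊆ exactPts d m := by
  classical
  rw [← filter_orbitFinset_eq hd hm hO]
  exact Finset.filter_subset _ _

theorem prod_exactPts_eq_prod_cycles {M : Type*} [CommMonoid M] (hd : 1 ≤ d) (hm : 1 ≤ m)
    (h : FracClosure ℤ[X] → M) :
    ∏ O ∈ cycles d m, ∏ α ∈ O, h α = ∏ α ∈ exactPts d m, h α := by
  classical
  rw [← Finset.prod_fiberwise_of_maps_to (s := exactPts d m) (t := cycles d m)
    (g := orbitFinset d m) fun α hα => Finset.mem_image_of_mem _ hα]
  exact Finset.prod_congr rfl fun O hO => by rw [filter_orbitFinset_eq hd hm hO]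

theorem cycles_pairwiseDisjoint (hd : 1 ≤ d) (hm : 1 ≤ m) :
    (cycles d m : Set (Finset (FracClosure ℤ[X]))).PairwiseDisjoint id := by
  classical
  intro O hO O' hO' hne
  rw [Function.onFun, id, id, Finset.disjoint_left]
  intro α h h'
  rw [Finset.mem_coe] at hO hO'
  rw [← filter_orbitFinset_eq hd hm hO, Finset.mem_filter] at h
  rw [← filter_orbitFinset_eq hd hm hO', Finset.mem_filter] at h'
  exact hne (h.2.symm.trans h'.2)

theorem card_mul_card_cycles (hd : 1 ≤ d) (hm : 1 ≤ m) :
    (cycles d m).card * m = (exactPts d m).card := by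
  have := prod_exactPts_eq_prod_cycles (M := Multiplicative ℕ) hd hm
    fun _ => Multiplicative.ofAdd 1
  simp only [Finset.prod_const, ← ofAdd_nsmul, smul_eq_mul, mul_one, ← ofAdd_sum] at this
  have h := Multiplicative.ofAdd.injective this
  rw [← h, Finset.sum_congr rfl fun O hO => card_of_mem_cycles hd hm hO, Finset.sum_const,
    smul_eq_mul]

theorem cyclePoly_monic : (cyclePoly d m).Monic := monic_prod_X_sub_C _ _

theorem natDegree_cyclePoly : (cyclePoly d m).natDegree = (cycles d m).card :=
  natDegree_finsetProd_X_sub_C_eq_card _ _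

/-- The multiplier is constant along a cycle, and each cycle has `m` points. -/
theorem cyclePoly_pow (hd : 1 ≤ d) (hm : 1 ≤ m) :
    cyclePoly d m ^ m = ∏ α ∈ exactPts d m, (X - C (multiplier (family d) m α)) := by
  classical
  rw [← prod_exactPts_eq_prod_cycles hd hm, cyclePoly, ← Finset.prod_pow]
  refine Finset.prod_congr rfl fun O hO => ?_
  rw [← card_of_mem_cycles hd hm hO, ← Finset.prod_const]
  refine Finset.prod_congr rfl fun α hα => ?_
  rw [← filter_orbitFinset_eq hd hm hO, Finset.mem_filter, mem_exactPts hd hm] at hα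
  rw [card_of_mem_cycles hd hm hO, ← prod_orbitFinset hα.1, hα.2]

theorem isMultiplierPolynomial_iff (hd : 1 ≤ d) (hm : 1 ≤ m) {δ : (FracClosure ℤ[X])[X]} :
    IsMultiplierPolynomial (family d) m δ ↔ δ = cyclePoly d m := by
  have key : ∀ Φ, IsDynatomic (family d) m Φ →
      ((Φ.aroots (FracClosure ℤ[X])).map fun α => X - C (multiplier (family d) m α)).prod =
        cyclePoly d m ^ m := fun Φ hΦ => by
    rw [aroots_of_isDynatomic hd hm hΦ, cyclePoly_pow hd hm]
    rfl
  constructor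
  · rintro ⟨h1, Φ, hΦ, h2⟩
    rw [key Φ hΦ] at h2
    exact monic_eq_of_pow_eq (by omega) h1 cyclePoly_monic h2
  · rintro rfl
    obtain ⟨Φ, hΦ⟩ := exists_dynatomic_factor hd m hm
    have hΦ' := isDynatomic_of_map_eq hd hm hΦ
    exact ⟨cyclePoly_monic, Φ, hΦ', (key Φ hΦ').symm⟩

section Galois

variable (σ : FracClosure ℤ[X] ≃ₐ[FractionRing ℤ[X]] FracClosure ℤ[X])

theorem algEquiv_cParam : σ cParam = cParam := by
  rw [cParam, IsScalarTower.algebraMap_apply ℤ[X] (FractionRing ℤ[X]) (FracClosure ℤ[X])]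
  exact σ.commutes _

theorem algEquiv_familyMap_iterate (k : ℕ) (α : FracClosure ℤ[X]) :
    σ ((familyMap d)^[k] α) = (familyMap d)^[k] (σ α) := by
  have h : Function.Semiconj σ (familyMap d) (familyMap d) := fun α => by
    simp [familyMap, algEquiv_cParam]
  exact h.iterate_right k α

theorem algEquiv_multiplier (α : FracClosure ℤ[X]) :
    σ (multiplier (family d) m α) = multiplier (family d) m (σ α) := by
  simp [multiplier_eq_prod, map_prod, familyDeriv, algEquiv_cParam, algEquiv_familyMap_iterate]

theorem minimalPeriod_algEquiv (α : FracClosure ℤ[X]) :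
    Function.minimalPeriod (familyMap d) (σ α) = Function.minimalPeriod (familyMap d) α := by
  refine Function.minimalPeriod_eq_minimalPeriod_iff.2 fun n => ?_
  rw [Function.IsPeriodicPt, Function.IsFixedPt, ← algEquiv_familyMap_iterate,
    σ.injective.eq_iff]
  rfl

/-- It suffices to compare `m`-th powers, where `σ` merely permutes the points of exact period `m`.
-/
theorem map_cyclePoly (hd : 1 ≤ d) (hm : 1 ≤ m) :
    (cyclePoly d m).map (σ : FracClosure ℤ[X] →+* FracClosure ℤ[X]) = cyclePoly d m := by
  refine monic_eq_of_pow_eq (n := m) (by omega) (cyclePoly_monic.map _) cyclePoly_monic ?_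
  rw [← Polynomial.map_pow, cyclePoly_pow hd hm, Polynomial.map_prod]
  refine Finset.prod_equiv σ.toEquiv (fun α => ?_) fun α _ => ?_
  · rw [mem_exactPts hd hm, mem_exactPts hd hm]
    exact (minimalPeriod_algEquiv σ α).symm ▸ Iff.rfl
  · simp [algEquiv_multiplier]

end Galois

theorem coeff_cyclePoly_mem_range (hd : 1 ≤ d) (hm : 1 ≤ m) (j : ℕ) :
    (cyclePoly d m).coeff j ∈ (algebraMap (FractionRing ℤ[X]) (FracClosure ℤ[X])).range := by
  refine (InfiniteGalois.mem_range_algebraMap_iff_fixed _).2 fun σ => ?_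
  conv_rhs => rw [← map_cyclePoly σ hd hm]
  rw [coeff_map]
  rfl

end Cycles

/-! ### The value polynomial in `t = dc` and `V = c + z^d`. -/

section Integrality

/-- Evaluation of integer polynomials at an element of the algebraic closure of `ℚ(c)`. -/
def evalAt (τ : FracClosure ℤ[X]) : ℤ[X] →+* FracClosure ℤ[X] :=
  eval₂RingHom (Int.castRingHom _) τ

@[simp] theorem evalAt_X (τ : FracClosure ℤ[X]) : evalAt τ X = τ := by simp [evalAt]

@[simp] theorem evalAt_C (τ : FracClosure ℤ[X]) (n : ℤ) : evalAt τ (C n) = n := by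
  simp [evalAt]

theorem algebraMap_eq_evalAt : algebraMap ℤ[X] (FracClosure ℤ[X]) = evalAt cParam := by
  refine Polynomial.ringHom_ext (fun n => ?_) ?_
  · simp
  · rw [evalAt_X, cParam]

theorem transcendental_cParam : Transcendental ℤ cParam := by
  rw [transcendental_iff]
  intro p hp
  rw [aeval_def, show algebraMap ℤ (FracClosure ℤ[X]) = Int.castRingHom _ from
    RingHom.ext_int _ _] at hp
  change evalAt cParam p = 0 at hp
  rwa [← algebraMap_eq_evalAt, map_eq_zero_iff _ algebraMap_fracClosure_injective] at hp

theorem evalAt_injective {τ : FracClosure ℤ[X]} (h : Transcendental ℤ τ) :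
    Function.Injective (evalAt τ) := by
  rw [injective_iff_map_eq_zero]
  intro p hp
  rw [transcendental_iff] at h
  refine h p ?_
  rwa [aeval_def, show algebraMap ℤ (FracClosure ℤ[X]) = Int.castRingHom _ from
    RingHom.ext_int _ _]

theorem evalAt_mul_cParam_injective {r : FracClosure ℤ[X]} (hr : IsAlgebraic ℤ r) (hr0 : r ≠ 0) :
    Function.Injective (evalAt (r * cParam)) := by
  refine evalAt_injective fun h => transcendental_cParam ?_
  simpa [hr0] using hr.inv.mul h

theorem evalAt_natCast_mul_cParam_injective {d : ℕ} (hd : 1 ≤ d) :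
    Function.Injective (evalAt (d * cParam)) :=
  evalAt_mul_cParam_injective (isAlgebraic_natCast d) (by exact_mod_cast (by omega : d ≠ 0))

theorem evalAt_inv_cParam_injective : Function.Injective (evalAt cParam⁻¹) :=
  evalAt_injective fun h => transcendental_cParam (by simpa using h.inv)

/-- The exponents `(d^{k}-1)/d` in base `d+1`. -/
def repunit (d : ℕ) : ℕ → ℕ
  | 0 => 0
  | k + 1 => (d + 1) * repunit d k + 1

theorem mul_repunit_add_one (d k : ℕ) : d * repunit d k + 1 = (d + 1) ^ k := by
  induction k with
  | zero => rfl
  | succ k ih => rw [repunit, pow_succ, ← ih]; ring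

/-- The polynomial `d V - t`, where `t` is the inner variable. -/
def linearForm (d : ℕ) : ℤ[X][X] := C (C (d : ℤ)) * X - C X

/-- `d^{e_k} f^{∘(k+1)}(z) / z` as a polynomial in `t = dc` and `V = c + z^d`. -/
def ratioPoly (d : ℕ) : ℕ → ℤ[X][X]
  | 0 => X
  | k + 1 => C (X * C (d : ℤ) ^ (d * repunit d k)) * ratioPoly d k +
      linearForm d * ratioPoly d k ^ (d + 1)

/-- The polynomial in `t` and `V` whose roots in `V` are the `c + α^d` for `f^{∘m}(α) = α`. -/
def valuePoly (d m : ℕ) : ℤ[X][X] :=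
  linearForm d * (ratioPoly d (m - 1) - C (C (d : ℤ) ^ repunit d (m - 1))) ^ d

variable {d m : ℕ}

theorem eval_map_linearForm (y : FracClosure ℤ[X]) :
    ((linearForm d).map (evalAt (d * cParam))).eval (cParam + y ^ d) = d * y ^ d := by
  simp [linearForm]; ring

theorem eval_map_ratioPoly (y : FracClosure ℤ[X]) (k : ℕ) :
    y * ((ratioPoly d k).map (evalAt (d * cParam))).eval (cParam + y ^ d) =
      d ^ repunit d k * (familyMap d)^[k + 1] y := by
  induction k with
  | zero => simp [ratioPoly, repunit, familyMap]; ring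
  | succ k ih =>
    rw [Function.iterate_succ_apply', ratioPoly, Polynomial.map_add, Polynomial.map_mul,
      Polynomial.map_mul, Polynomial.map_pow, eval_add, eval_mul, eval_mul, eval_pow,
      eval_map_linearForm, map_C, eval_C, map_mul, map_pow, evalAt_X, evalAt_C]
    set H := ((ratioPoly d k).map (evalAt (d * cParam))).eval (cParam + y ^ d)
    set F := (familyMap d)^[k + 1] y
    calc _ = d * cParam * d ^ (d * repunit d k) * (y * H) + d * (y * H) ^ (d + 1) := by
          push_cast; ring
      _ = _ := by
          rw [ih, familyMap, repunit]; ring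

theorem eval_map_valuePoly (hm : 1 ≤ m) (y : FracClosure ℤ[X]) :
    ((valuePoly d m).map (evalAt (d * cParam))).eval (cParam + y ^ d) =
      d ^ (d + 1) ^ (m - 1) * ((familyMap d)^[m] y - y) ^ d := by
  obtain ⟨k, rfl⟩ : ∃ k, m = k + 1 := ⟨m - 1, by omega⟩
  rw [valuePoly, Polynomial.map_mul, eval_mul, eval_map_linearForm, Polynomial.map_pow, eval_pow,
    Polynomial.map_sub, eval_sub, mul_assoc, ← mul_pow, mul_sub, Nat.add_sub_cancel,
    eval_map_ratioPoly, ← mul_repunit_add_one, map_C, eval_C, map_pow, evalAt_C,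
    Int.cast_natCast, mul_comm y, ← mul_sub, mul_pow]
  ring

theorem familyMap_mul {ζ : FracClosure ℤ[X]} (hζ : ζ ^ d = 1) (α : FracClosure ℤ[X]) (k : ℕ) :
    (familyMap d)^[k] (ζ * α) = ζ * (familyMap d)^[k] α := by
  have h : Function.Semiconj (ζ * ·) (familyMap d) (familyMap d) := fun α => by
    simp only [familyMap, mul_pow, pow_succ ζ, hζ]; ring
  exact (h.iterate_right k α).symm

/-- `f` commutes with multiplication by `d`-th roots of unity, so these permute the fixed points.
Factoring `y^d - α^d` into the `y - ζα` yields `d` equal products. -/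
theorem prod_fixedPts_pow_sub_pow (hd : 1 ≤ d) (hm : 1 ≤ m) (y : FracClosure ℤ[X]) :
    ∏ α ∈ fixedPts d m, (y ^ d - α ^ d) = ((familyMap d)^[m] y - y) ^ d := by
  have hd0 : (d : FracClosure ℤ[X]) ≠ 0 := by exact_mod_cast (by omega : d ≠ 0)
  have : NeZero (d : FracClosure ℤ[X]) := ⟨hd0⟩
  have : NeZero d := ⟨by omega⟩
  obtain ⟨ξ, hξ⟩ := HasEnoughRootsOfUnity.exists_primitiveRoot (FracClosure ℤ[X]) d
  have hprod : ∏ α ∈ fixedPts d m, (y - α) = (familyMap d)^[m] y - y := by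
    have := congrArg (eval y) (map_periodPoly hd hm)
    rw [eval_map, ← aeval_def, aeval_periodPoly, eval_prod] at this
    simpa using this.symm
  simp_rw [hξ.pow_sub_pow_eq_prod_sub_mul y _ (by omega : 0 < d)]
  rw [Finset.prod_comm]
  have hone : ∀ ζ ∈ nthRootsFinset d (1 : FracClosure ℤ[X]),
      ∏ α ∈ fixedPts d m, (y - ζ * α) = (familyMap d)^[m] y - y := by
    intro ζ hζ
    rw [mem_nthRootsFinset (by omega)] at hζ
    have hζ0 : ζ ≠ 0 := by
      rintro rfl
      rw [zero_pow (by omega)] at hζ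
      exact zero_ne_one hζ
    rw [← hprod]
    refine Finset.prod_equiv (Equiv.mulLeft₀ ζ hζ0) (fun α => ?_) fun α _ => rfl
    rw [mem_fixedPts hd hm, mem_fixedPts hd hm]
    change _ ↔ (familyMap d)^[m] (ζ * α) = ζ * α
    rw [familyMap_mul hζ, mul_right_inj' hζ0]
  rw [Finset.prod_congr rfl hone, Finset.prod_const, hξ.card_nthRootsFinset]

theorem map_valuePoly (hd : 1 ≤ d) (hm : 1 ≤ m) :
    (valuePoly d m).map (evalAt (d * cParam)) =
      C ((d : FracClosure ℤ[X]) ^ (d + 1) ^ (m - 1)) * ∏ α ∈ fixedPts d m, (X - C (cParam + α ^ d)) := by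
  refine Polynomial.funext fun v => ?_
  -- Every `v` has the form `c + y^d`, so both sides can be compared through `y`.
  obtain ⟨y, hy⟩ := IsAlgClosed.exists_pow_nat_eq (v - cParam) (by omega : 0 < d)
  obtain rfl : v = cParam + y ^ d := by rw [hy]; ring
  rw [eval_map_valuePoly hm, ← prod_fixedPts_pow_sub_pow hd hm, eval_mul, eval_C, eval_prod]
  congr 1
  refine Finset.prod_congr rfl fun α _ => ?_
  simp

/-- The specialization `t ↦ (d+1) s`, `V ↦ s`, which corresponds to the critical points. -/
def criticalSpec (d : ℕ) : ℤ[X][X] →+* ℤ[X] :=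
  eval₂RingHom (compRingHom (C ((d : ℤ) + 1) * X)) X

@[simp] theorem criticalSpec_X : criticalSpec d X = X := by simp [criticalSpec]

@[simp] theorem criticalSpec_C (p : ℤ[X]) :
    criticalSpec d (C p) = p.comp (C ((d : ℤ) + 1) * X) := by simp [criticalSpec]

theorem criticalSpec_linearForm : criticalSpec d (linearForm d) = -X := by
  simp [linearForm]; ring

/-- A polynomial of degree `n` with leading coefficient `±1`. -/
def UnitLeading (p : ℤ[X]) (n : ℕ) : Prop := IsUnit p.leadingCoeff ∧ p.natDegree = n

theorem UnitLeading.ne_zero {p : ℤ[X]} {n : ℕ} (h : UnitLeading p n) : p ≠ 0 := by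
  rintro rfl
  simpa using h.1

theorem UnitLeading.mul {p q : ℤ[X]} {a b : ℕ} (hp : UnitLeading p a) (hq : UnitLeading q b) :
    UnitLeading (p * q) (a + b) := by
  refine ⟨?_, ?_⟩
  · rw [leadingCoeff_mul]; exact hp.1.mul hq.1
  · rw [natDegree_mul hp.ne_zero hq.ne_zero, hp.2, hq.2]

theorem UnitLeading.pow {p : ℤ[X]} {a : ℕ} (hp : UnitLeading p a) (n : ℕ) :
    UnitLeading (p ^ n) (n * a) := by
  refine ⟨?_, ?_⟩
  · rw [leadingCoeff_pow]; exact hp.1.pow n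
  · rw [natDegree_pow, hp.2]

theorem UnitLeading.add {p q : ℤ[X]} {a : ℕ} (hp : UnitLeading p a) (hq : q.natDegree < a) :
    UnitLeading (q + p) a := by
  have hlt : q.natDegree < p.natDegree := hp.2 ▸ hq
  refine ⟨?_, ?_⟩
  · rw [leadingCoeff_add_of_degree_lt (degree_lt_degree hlt)]; exact hp.1
  · rw [natDegree_add_eq_right_of_natDegree_lt hlt, hp.2]

theorem unitLeading_neg_X : UnitLeading (-X) 1 := by
  refine ⟨?_, by simp⟩
  rw [leadingCoeff_neg, leadingCoeff_X]
  exact isUnit_one.neg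

/-- Under the specialization `dV - t` becomes `-s`, so the `(d+1)`-st power term dominates the
recursion and carries no power of `d`. -/
theorem unitLeading_criticalSpec_ratioPoly (hd : 1 ≤ d) (k : ℕ) :
    UnitLeading (criticalSpec d (ratioPoly d k)) (repunit d (k + 1)) := by
  induction k with
  | zero => exact ⟨by simp [ratioPoly], by simp [ratioPoly, repunit]⟩
  | succ k ih =>
    rw [ratioPoly, map_add, map_mul (criticalSpec d) (C _), map_mul (criticalSpec d) (linearForm d),
      map_pow (criticalSpec d), criticalSpec_linearForm, criticalSpec_C]
    have h := unitLeading_neg_X.mul (ih.pow (d + 1))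
    rw [add_comm 1, ← repunit] at h
    refine h.add ?_
    have h1 : ((X * C (d : ℤ) ^ (d * repunit d k)).comp (C ((d : ℤ) + 1) * X)).natDegree ≤ 1 := by
      rw [← C_pow, mul_comp, X_comp, C_comp]
      compute_degree
    refine natDegree_mul_le.trans_lt ?_
    rw [ih.2]
    have h2 : 1 ≤ repunit d (k + 1) := by rw [repunit]; omega
    have h3 : repunit d (k + 1 + 1) = (d + 1) * repunit d (k + 1) + 1 := rfl
    rw [h3]
    nlinarith

theorem unitLeading_criticalSpec_valuePoly (hd : 1 ≤ d) (hm : 1 ≤ m) :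
    UnitLeading (criticalSpec d (valuePoly d m)) ((d + 1) ^ m) := by
  obtain ⟨k, rfl⟩ : ∃ k, m = k + 1 := ⟨m - 1, by omega⟩
  rw [valuePoly, map_mul, map_pow, criticalSpec_linearForm, Nat.add_sub_cancel, map_sub,
    ← mul_repunit_add_one, add_comm _ 1, sub_eq_neg_add]
  refine unitLeading_neg_X.mul (((unitLeading_criticalSpec_ratioPoly hd k).add ?_).pow d)
  rw [criticalSpec_C, ← C_pow, C_comp, ← C_neg, natDegree_C, repunit]
  omega

theorem isUnit_of_comp {r : ℤ[X]} (hd : 1 ≤ d)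
    (h : IsUnit (r.comp (C ((d : ℤ) + 1) * X)).leadingCoeff) : IsUnit r := by
  have hd1 : ((d : ℤ) + 1) ≠ 0 := by positivity
  have hlin : (C ((d : ℤ) + 1) * X).natDegree = 1 := natDegree_C_mul_X _ hd1
  rw [leadingCoeff_comp (by rw [hlin]; exact one_ne_zero), leadingCoeff_C_mul_X,
    IsUnit.mul_iff] at h
  have h0 : r.natDegree = 0 := by
    by_contra hne
    have h' := Int.isUnit_iff.1 ((isUnit_pow_iff hne).1 h.2)
    omega
  rw [eq_C_of_natDegree_eq_zero h0, isUnit_C]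
  rw [leadingCoeff, h0] at h
  exact h.1

/-- A common divisor `r(t)` of the coefficients gives a divisor `r((d+1)s)` of a polynomial with
leading coefficient `±1`; as `d + 1 ≥ 2`, this forces `r` to be a unit. -/
theorem valuePoly_isPrimitive (hd : 1 ≤ d) (hm : 1 ≤ m) : (valuePoly d m).IsPrimitive := by
  intro r hr
  obtain ⟨q, hq⟩ := map_dvd (criticalSpec d) hr
  have h := (unitLeading_criticalSpec_valuePoly hd hm).1
  rw [hq, criticalSpec_C, leadingCoeff_mul] at h
  exact isUnit_of_comp hd (isUnit_of_mul_isUnit_left h)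

/-- The polynomial with roots `c + α^d`, for `α` of exact period `k`, scaled to be integral
in `t = dc`. -/
theorem exists_valueFactor (hd : 1 ≤ d) : ∀ k, 1 ≤ k → ∃ g : ℤ[X][X],
    g.map (evalAt (d * cParam)) = C ((d : FracClosure ℤ[X]) ^ ((exactPts d k).card / (d + 1))) *
      ∏ α ∈ exactPts d k, (X - C (cParam + α ^ d)) := by
  intro k hk
  obtain ⟨g, -, hg⟩ := exists_primitive_factor (ψ := evalAt (d * cParam)) (p := valuePoly d)
    (G := fun k => ∏ α ∈ exactPts d k, (X - C (cParam + α ^ d)))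
    (a := fun k => C (d : ℤ) ^ ((exactPts d k).card / (d + 1)))
    (evalAt_natCast_mul_cParam_injective hd) (fun m hm => valuePoly_isPrimitive hd hm)
    (fun _ _ => pow_ne_zero _ (C_ne_zero.2 (by exact_mod_cast (by omega : d ≠ 0))))
    (fun k => monic_prod_X_sub_C _ _) (fun m hm => by
      rw [Finset.prod_mul_distrib,
        prod_divisors_exactPts hd hm (fun α => X - C (cParam + α ^ d)), map_valuePoly hd hm,
        ← map_prod, ← map_prod, Finset.prod_pow_eq_pow_sum, sum_card_exactPts_div hd hm,
        map_pow (evalAt _), evalAt_C, Int.cast_natCast]) k hk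
  exact ⟨g, by simpa using hg⟩

/-- Specialization respects the factorisation over divisors: leading coefficients of the factors
divide a unit, and their degrees are determined by the divisor sums `(d+1)^n`. -/
theorem exists_valueFactor_unitLeading (hd : 1 ≤ d) (hm : 1 ≤ m) : ∃ g : ℤ[X][X],
    g.map (evalAt (d * cParam)) = C ((d : FracClosure ℤ[X]) ^ ((exactPts d m).card / (d + 1))) *
      ∏ α ∈ exactPts d m, (X - C (cParam + α ^ d)) ∧
    UnitLeading (criticalSpec d g) (exactPts d m).card := by
  choose! g hg using exists_valueFactor hd
  have hprod : ∀ n, 1 ≤ n → ∏ k ∈ n.divisors, g k = valuePoly d n := fun n hn => by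
    refine map_injective _ (evalAt_natCast_mul_cParam_injective hd) ?_
    rw [Polynomial.map_prod, map_valuePoly hd hn,
      Finset.prod_congr rfl fun k hk => hg k (Nat.pos_of_mem_divisors hk),
      Finset.prod_mul_distrib, prod_divisors_exactPts hd hn (fun α => X - C (cParam + α ^ d)),
      ← map_prod, Finset.prod_pow_eq_pow_sum, sum_card_exactPts_div hd hn]
  have hspec : ∀ n, 1 ≤ n →
      UnitLeading (∏ k ∈ n.divisors, criticalSpec d (g k)) ((d + 1) ^ n) := fun n hn => by
    rw [← map_prod, hprod n hn]
    exact unitLeading_criticalSpec_valuePoly hd hn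
  refine ⟨g m, hg m hm, ?_, ?_⟩
  · have h := (hspec m hm).1
    rw [leadingCoeff_prod] at h
    exact isUnit_of_dvd_unit (Finset.dvd_prod_of_mem (fun k => (criticalSpec d (g k)).leadingCoeff)
      (Nat.mem_divisors_self m (by omega))) h
  · refine sum_divisors_injective (a := fun k => (criticalSpec d (g k)).natDegree)
      (b := fun k => (exactPts d k).card) (fun n hn => ?_) m hm
    rw [sum_card_exactPts hd hn, ← (hspec n hn).2, natDegree_prod]
    intro k hk h0
    exact (hspec n hn).ne_zero (Finset.prod_eq_zero hk h0)

end Integrality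

/-! ### Coefficients in `ℤ[dc]`, their degrees, and monicity. -/

section Specialization

variable {d m : ℕ}

theorem isIntegrallyClosed_range_evalAt {τ : FracClosure ℤ[X]}
    (h : Function.Injective (evalAt τ)) : IsIntegrallyClosed (evalAt τ).range :=
  IsIntegrallyClosed.of_equiv (RingEquiv.ofBijective (evalAt τ).rangeRestrict
    ⟨fun _ _ hab => h (congrArg Subtype.val hab), (evalAt τ).rangeRestrict_surjective⟩)

theorem evalAt_mem_subfield {F : Subfield (FracClosure ℤ[X])} {τ : FracClosure ℤ[X]} (h : τ ∈ F)
    (p : ℤ[X]) : evalAt τ p ∈ F := by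
  rw [evalAt, coe_eval₂RingHom, eval₂_eq_sum_range]
  exact sum_mem fun i _ => mul_mem (intCast_mem _ _) (pow_mem h i)

theorem mem_subfield_of_mem_range {F : Subfield (FracClosure ℤ[X])} (h : cParam ∈ F)
    {x : FracClosure ℤ[X]} (hx : x ∈ (algebraMap (FractionRing ℤ[X]) (FracClosure ℤ[X])).range) :
    x ∈ F := by
  obtain ⟨y, rfl⟩ := hx
  obtain ⟨a, b, -, rfl⟩ := IsFractionRing.div_surjective (A := ℤ[X]) y
  rw [map_div₀, ← IsScalarTower.algebraMap_apply, ← IsScalarTower.algebraMap_apply,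
    algebraMap_eq_evalAt]
  exact div_mem (evalAt_mem_subfield h a) (evalAt_mem_subfield h b)

theorem mem_range_evalAt {τ x : FracClosure ℤ[X]} (hτ : Function.Injective (evalAt τ))
    (hc : cParam ∈ Subfield.closure ((evalAt τ).range : Set (FracClosure ℤ[X])))
    (hx : x ∈ (algebraMap (FractionRing ℤ[X]) (FracClosure ℤ[X])).range)
    (hint : IsIntegral (evalAt τ).range x) : ∃ p, evalAt τ p = x := by
  have := isIntegrallyClosed_range_evalAt hτ
  exact mem_subring_of_isIntegral (mem_subfield_of_mem_range hc hx) hint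

theorem mem_closure_range_evalAt (τ : FracClosure ℤ[X]) :
    τ ∈ Subfield.closure ((evalAt τ).range : Set (FracClosure ℤ[X])) :=
  Subfield.subset_closure ⟨X, evalAt_X τ⟩

theorem isIntegral_evalAt (τ : FracClosure ℤ[X]) (p : ℤ[X]) :
    IsIntegral (evalAt τ).range (evalAt τ p) :=
  isIntegral_algebraMap (x := (⟨evalAt τ p, p, rfl⟩ : (evalAt τ).range))

theorem familyDeriv_eq (α : FracClosure ℤ[X]) :
    familyDeriv d α = (d + 1) * (cParam + α ^ d) + -(d * cParam) := by
  rw [familyDeriv]; ring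

theorem prod_cycleMultiplier (hd : 1 ≤ d) (hm : 1 ≤ m) {u : Finset (Finset (FracClosure ℤ[X]))}
    (hu : u ⊆ cycles d m) : ∃ t ⊆ exactPts d m,
      ∏ O ∈ u, cycleMultiplier d O = ∏ α ∈ t, familyDeriv d α := by
  classical
  refine ⟨u.biUnion id, Finset.biUnion_subset.2 fun O hO => subset_of_mem_cycles hd hm (hu hO), ?_⟩
  rw [Finset.prod_biUnion ((cycles_pairwiseDisjoint hd hm).subset (by exact_mod_cast hu))]
  rfl

theorem exists_lift_coeff (hd : 1 ≤ d) (hm : 1 ≤ m) (j : ℕ) : ∃ p : ℤ[X],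
    evalAt (d * cParam) p = d ^ ((exactPts d m).card / (d + 1)) * (cyclePoly d m).coeff j := by
  classical
  have hd0 : (d : FracClosure ℤ[X]) ≠ 0 := by exact_mod_cast (by omega : d ≠ 0)
  refine mem_range_evalAt (evalAt_natCast_mul_cParam_injective hd) ?_ ?_ ?_
  · have := div_mem (mem_closure_range_evalAt (d * cParam)) (natCast_mem
      (Subfield.closure ((evalAt (d * cParam)).range : Set (FracClosure ℤ[X]))) d)
    rwa [mul_div_cancel_left₀ _ hd0] at this
  · exact mul_mem (pow_mem (natCast_mem _ _) _) (coeff_cyclePoly_mem_range hd hm j)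
  · obtain ⟨g, hg⟩ := exists_valueFactor hd m hm
    refine isIntegral_coeff_of_subprods j fun u hu _ => ?_
    -- Distinct cycles are disjoint, so a product of multipliers runs over distinct periodic points
    -- and the subset-product bound applies.
    obtain ⟨t, ht, h⟩ := prod_cycleMultiplier hd hm hu
    rw [h]
    simp_rw [familyDeriv_eq]
    refine isIntegral_mul_prod_affine ht ?_ ?_ (v := fun α => cParam + α ^ d) fun i => ?_
    · simpa using isIntegral_evalAt (d * cParam) (C ((d : ℤ) + 1))
    · simpa using isIntegral_evalAt (d * cParam) (-X)
    · rw [← hg, coeff_map]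
      exact isIntegral_evalAt _ _

/-! ### Growth of the multipliers at `c = ∞`. -/

section Infinity

/-- The iterates of `w ↦ w^{d+1} + w`, rescaled by powers of `s` so as to be monic. -/
def scaledIter {R : Type*} [CommRing R] (d : ℕ) (s : R) : ℕ → R[X]
  | 0 => X
  | k + 1 => scaledIter d s k ^ (d + 1) + C (s ^ (d * repunit d k)) * scaledIter d s k

theorem scaledIter_monic_natDegree {R : Type*} [CommRing R] [Nontrivial R] (hd : 1 ≤ d) (s : R)
    (k : ℕ) : (scaledIter d s k).Monic ∧ (scaledIter d s k).natDegree = (d + 1) ^ k := by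
  induction k with
  | zero => exact ⟨monic_X, natDegree_X⟩
  | succ k ih =>
    have h1 : (scaledIter d s k ^ (d + 1)).natDegree = (d + 1) ^ (k + 1) := by
      rw [ih.1.natDegree_pow, ih.2, pow_succ']
    have hlt : (C (s ^ (d * repunit d k)) * scaledIter d s k).natDegree <
        (scaledIter d s k ^ (d + 1)).natDegree := by
      refine (natDegree_C_mul_le _ _).trans_lt ?_
      rw [h1, ih.2]
      exact Nat.pow_lt_pow_right (by omega) (by omega)
    exact ⟨(ih.1.pow _).add_of_left (degree_lt_degree hlt),
      (natDegree_add_eq_left_of_natDegree_lt hlt).trans h1⟩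

/-- With `w = z/ρ` and `ρ^d = c`, the map becomes `w ↦ c (w^(d+1) + w)`. The powers of `1/c` absorb
the factors `c`, giving a monic equation over `ℤ[1/c]` for the rescaled fixed points. -/
theorem aeval_scaledIter {R : Type*} [CommRing R] [Algebra R (FracClosure ℤ[X])] {s : R}
    (hs : algebraMap R (FracClosure ℤ[X]) s = cParam⁻¹) {ρ : FracClosure ℤ[X]}
    (hρ : ρ ^ d = cParam) (hρ0 : ρ ≠ 0) (α : FracClosure ℤ[X]) (k : ℕ) :
    aeval (α / ρ) (scaledIter d s k) =
      cParam⁻¹ ^ repunit d k * ((familyMap d)^[k] α / ρ) := by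
  induction k with
  | zero => simp [scaledIter, repunit]
  | succ k ih =>
    rw [Function.iterate_succ_apply', scaledIter, map_add, map_pow, map_mul, aeval_C, ih, map_pow,
      hs, repunit]
    set F := (familyMap d)^[k] α
    have h : cParam⁻¹ * (familyMap d F / ρ) = (F / ρ) ^ (d + 1) + F / ρ := by
      rw [familyMap, ← hρ, div_pow]
      field_simp
      ring
    rw [pow_succ _ ((d + 1) * repunit d k), mul_assoc, h]
    ring

theorem isIntegral_div_of_mem_fixedPts (hd : 1 ≤ d) (hm : 1 ≤ m) {ρ α : FracClosure ℤ[X]}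
    (hρ : ρ ^ d = cParam) (hα : α ∈ fixedPts d m) :
    IsIntegral (evalAt cParam⁻¹).range (α / ρ) := by
  have hρ0 : ρ ≠ 0 := by
    rintro rfl
    rw [zero_pow (by omega)] at hρ
    exact cParam_ne_zero hρ.symm
  set s : (evalAt cParam⁻¹).range := ⟨cParam⁻¹, X, evalAt_X _⟩
  obtain ⟨h1, h2⟩ := scaledIter_monic_natDegree hd s m
  have hlt : (C (s ^ repunit d m) * X).natDegree < (scaledIter d s m).natDegree := by
    rw [h2]
    exact (natDegree_C_mul_le _ _).trans_lt (natDegree_X.trans_lt (Nat.one_lt_pow (by omega) (by omega)))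
  refine ⟨scaledIter d s m - C (s ^ repunit d m) * X, h1.sub_of_left (degree_lt_degree hlt), ?_⟩
  rw [← aeval_def, map_sub, aeval_scaledIter (s := s) rfl hρ hρ0, map_mul, aeval_C, aeval_X,
    map_pow, (mem_fixedPts hd hm).1 hα, show algebraMap (evalAt cParam⁻¹).range _ s = cParam⁻¹
      from rfl, sub_self]

theorem isIntegral_familyDeriv_mul (hd : 1 ≤ d) (hm : 1 ≤ m) {α : FracClosure ℤ[X]}
    (hα : α ∈ fixedPts d m) :
    IsIntegral (evalAt cParam⁻¹).range (familyDeriv d α * cParam⁻¹) := by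
  obtain ⟨ρ, hρ⟩ := IsAlgClosed.exists_pow_nat_eq cParam (by omega : 0 < d)
  -- That is, `f'(α)/c = (d+1)(α/ρ)^d + 1`.
  have h : familyDeriv d α * cParam⁻¹ =
      evalAt cParam⁻¹ (C ((d : ℤ) + 1)) * (α / ρ) ^ d + evalAt cParam⁻¹ (C 1) := by
    have := cParam_ne_zero
    rw [div_pow, hρ, familyDeriv, evalAt_C, evalAt_C]
    field_simp
    push_cast
    ring
  rw [h]
  exact ((isIntegral_evalAt _ _).mul ((isIntegral_div_of_mem_fixedPts hd hm hρ hα).pow d)).add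
    (isIntegral_evalAt _ _)

theorem exists_coeff_mul_eq_evalAt_inv (hd : 1 ≤ d) (hm : 1 ≤ m) {j : ℕ} :
    ∃ q : ℤ[X], evalAt cParam⁻¹ q =
      cParam⁻¹ ^ (((cycles d m).card - j) * m) * (cyclePoly d m).coeff j := by
  classical
  refine mem_range_evalAt evalAt_inv_cParam_injective ?_ ?_ ?_
  · simpa using inv_mem (mem_closure_range_evalAt cParam⁻¹)
  · refine mul_mem (pow_mem ?_ _) (coeff_cyclePoly_mem_range hd hm j)
    refine ⟨(algebraMap ℤ[X] _ X)⁻¹, ?_⟩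
    rw [map_inv₀, ← IsScalarTower.algebraMap_apply, cParam]
  · refine isIntegral_coeff_of_subprods j fun u hu hcard => ?_
    rw [show (cycles d m).card - j = u.card by omega, mul_comm _ m, pow_mul, ← Finset.prod_const,
      ← Finset.prod_mul_distrib]
    refine IsIntegral.prod _ fun O hO => ?_
    rw [cycleMultiplier, ← card_of_mem_cycles hd hm (hu hO), ← Finset.prod_const,
      ← Finset.prod_mul_distrib]
    refine IsIntegral.prod _ fun α hα => ?_
    rw [mul_comm]
    refine isIntegral_familyDeriv_mul hd hm ?_
    exact Finset.mem_of_mem_filter α (subset_of_mem_cycles hd hm (hu hO) hα)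

/-- If `c^(-M) p(c)` is a polynomial in `1/c`, then `p` has degree at most `M`; reversing `q` turns
this into an identity in `ℤ[c]`. -/
theorem natDegree_le_of_evalAt_inv {p q : ℤ[X]} {M : ℕ}
    (h : evalAt cParam⁻¹ q = cParam⁻¹ ^ M * evalAt cParam p) : p.natDegree ≤ M := by
  by_cases hp : p = 0
  · simp [hp]
  have hc := cParam_ne_zero
  have hrev : evalAt cParam q.reverse = cParam ^ q.natDegree * evalAt cParam⁻¹ q := by
    let : Invertible (cParam⁻¹) := invertibleOfNonzero (inv_ne_zero hc)
    have := eval₂_reverse_mul_pow (Int.castRingHom (FracClosure ℤ[X])) cParam⁻¹ q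
    rw [invOf_eq_inv, inv_inv] at this
    change evalAt cParam q.reverse * _ = evalAt cParam⁻¹ q at this
    rw [← this, mul_left_comm, ← mul_pow, mul_inv_cancel₀ hc, one_pow, mul_one]
  have heq : X ^ M * q.reverse = X ^ q.natDegree * p := by
    refine algebraMap_fracClosure_injective ?_
    rw [algebraMap_eq_evalAt, map_mul, map_mul, map_pow, map_pow, evalAt_X, hrev, h,
      mul_left_comm (cParam ^ M), ← mul_assoc (cParam ^ M), ← mul_pow, mul_inv_cancel₀ hc, one_pow,
      one_mul]
  have hdeg := congrArg natDegree heq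
  rw [natDegree_X_pow_mul _ hp] at hdeg
  have h1 := natDegree_mul_le (p := X ^ M) (q := q.reverse)
  rw [natDegree_X_pow] at h1
  have h2 := reverse_natDegree_le q
  omega

theorem evalAt_comp (r : ℤ) (τ : FracClosure ℤ[X]) (p : ℤ[X]) :
    evalAt τ (p.comp (C r * X)) = evalAt (r * τ) p := by
  change ((evalAt τ).comp (compRingHom (C r * X))) p = _
  congr 1
  refine Polynomial.ringHom_ext (fun n => by simp) (by simp)

theorem natDegree_comp_C_mul_X {r : ℤ} (hr : r ≠ 0) (p : ℤ[X]) :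
    (p.comp (C r * X)).natDegree = p.natDegree := by
  rw [natDegree_comp, natDegree_C_mul_X _ hr, mul_one]

theorem natDegree_le_of_evalAt_eq (hd : 1 ≤ d) (hm : 1 ≤ m) {j : ℕ} {p : ℤ[X]} {a : ℕ}
    (hp : evalAt (d * cParam) p = d ^ a * (cyclePoly d m).coeff j) :
    p.natDegree ≤ ((cycles d m).card - j) * m := by
  have hd0 : (d : ℤ) ≠ 0 := by exact_mod_cast (by omega : d ≠ 0)
  obtain ⟨q, hq⟩ := exists_coeff_mul_eq_evalAt_inv hd hm (j := j)
  rw [← natDegree_comp_C_mul_X hd0]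
  refine natDegree_le_of_evalAt_inv (q := C ((d : ℤ) ^ a) * q) ?_
  rw [evalAt_comp, Int.cast_natCast, hp, map_mul, hq, evalAt_C]
  push_cast
  ring

end Infinity

theorem evalAt_criticalSpec (g : ℤ[X][X]) (τ : FracClosure ℤ[X]) :
    evalAt τ (criticalSpec d g) = (g.map (evalAt (((d : ℤ) + 1 : ℤ) * τ))).eval τ := by
  rw [eval_map]
  change ((evalAt τ).comp (criticalSpec d)) g = eval₂RingHom _ τ g
  congr 1
  refine Polynomial.ringHom_ext (fun p => ?_) (by simp)
  rw [RingHom.comp_apply, criticalSpec_C, evalAt_comp, coe_eval₂RingHom, eval₂_C]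

/-- For `τ = dc/(d+1)` one has `(d+1)(τ - (c + α^d)) = -f'(α)`, so the constant coefficient is the
specialized value factor times `±(d+1)^ν`. Substituting `t = (d+1)s` in `p` produces the same
`(d+1)^ν`, and the two cancel in the leading coefficients. -/
theorem unitLeading_of_evalAt_eq (hd : 1 ≤ d) (hm : 1 ≤ m) {p : ℤ[X]}
    (hp : evalAt (d * cParam) p =
      d ^ ((exactPts d m).card / (d + 1)) * (cyclePoly d m).coeff 0) :
    UnitLeading p (exactPts d m).card := by
  have hd0 : (d : FracClosure ℤ[X]) ≠ 0 := by exact_mod_cast (by omega : d ≠ 0)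
  have hd1 : (d : FracClosure ℤ[X]) + 1 ≠ 0 := by exact_mod_cast (by omega : d + 1 ≠ 0)
  have hd1' : (d : ℤ) + 1 ≠ 0 := by positivity
  set ν := (exactPts d m).card
  set n := (cycles d m).card
  obtain ⟨g, hg, hlead⟩ := exists_valueFactor_unitLeading hd hm
  set τ : FracClosure ℤ[X] := d * (d + 1 : FracClosure ℤ[X])⁻¹ * cParam
  have hτ : (((d : ℤ) + 1 : ℤ) : FracClosure ℤ[X]) * τ = d * cParam := by
    push_cast; simp only [τ]; field_simp
  have hinj : Function.Injective (evalAt τ) := by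
    refine evalAt_mul_cParam_injective ((isAlgebraic_natCast d).mul ?_)
      (mul_ne_zero hd0 (inv_ne_zero hd1))
    exact_mod_cast (isAlgebraic_natCast (d + 1)).inv
  have hcoeff : (cyclePoly d m).coeff 0 = (-1) ^ n * ∏ α ∈ exactPts d m, familyDeriv d α := by
    rw [coeff_zero_eq_eval_zero, cyclePoly, eval_prod, ← prod_exactPts_eq_prod_cycles hd hm,
      ← Finset.prod_const, ← Finset.prod_mul_distrib]
    refine Finset.prod_congr rfl fun O _ => ?_
    rw [eval_sub, eval_X, eval_C, zero_sub, cycleMultiplier, neg_one_mul]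
  have hspec : ((d : FracClosure ℤ[X]) + 1) ^ ν * evalAt τ (criticalSpec d g) =
      (-1) ^ ν * (d ^ (ν / (d + 1)) * ∏ α ∈ exactPts d m, familyDeriv d α) := by
    rw [evalAt_criticalSpec, hτ, hg, eval_mul, eval_C, eval_prod, mul_left_comm,
      ← Finset.prod_const, ← Finset.prod_mul_distrib, mul_left_comm, ← Finset.prod_const,
      ← Finset.prod_mul_distrib]
    congr 1
    refine Finset.prod_congr rfl fun α _ => ?_
    simp only [eval_sub, eval_X, eval_C, τ, familyDeriv]
    field_simp
    ring
  have heq : p.comp (C ((d : ℤ) + 1) * X) =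
      C ((-1) ^ (n + ν) * ((d : ℤ) + 1) ^ ν) * criticalSpec d g := by
    refine hinj ?_
    rw [evalAt_comp, hτ, hp, hcoeff, map_mul, evalAt_C]
    push_cast
    rw [mul_assoc, hspec, pow_add, mul_assoc, ← mul_assoc ((-1) ^ ν), ← pow_add, ← two_mul,
      pow_mul, neg_one_sq, one_pow, one_mul]
    ring
  have hne : ((-1) ^ (n + ν) * ((d : ℤ) + 1) ^ ν) ≠ 0 :=
    mul_ne_zero (pow_ne_zero _ (by norm_num)) (pow_ne_zero _ hd1')
  have hdeg : p.natDegree = ν := by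
    rw [← natDegree_comp_C_mul_X hd1', heq, natDegree_C_mul hne, hlead.2]
  refine ⟨?_, hdeg⟩
  have hlc := congrArg leadingCoeff heq
  rw [leadingCoeff_comp (by rw [natDegree_C_mul_X _ hd1']; exact one_ne_zero), hdeg,
    leadingCoeff_C_mul_X, leadingCoeff_mul, leadingCoeff_C, mul_right_comm] at hlc
  rw [mul_right_cancel₀ (pow_ne_zero _ hd1') hlc]
  exact (isUnit_one.neg.pow _).mul hlead.1

theorem specialize_swap (Q : ℤ[X][X]) (τ : FracClosure ℤ[X]) :
    specialize (Bivariate.swap Q) τ = Q.map (evalAt τ) := by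
  change (eval₂RingHom (mapRingHom (algebraMap ℤ (FracClosure ℤ[X]))) (C τ)).comp
    (Bivariate.swap (R := ℤ) : ℤ[X][X] →+* ℤ[X][X]) Q = mapRingHom (evalAt τ) Q
  congr 1
  refine Polynomial.ringHom_ext' (Polynomial.ringHom_ext (fun n => ?_) ?_) ?_
  · simp
  · simp [Bivariate.swap_X]
  · simp [Bivariate.swap_Y]

theorem coeff_coeff_swap (Q : ℤ[X][X]) (i j : ℕ) :
    ((Bivariate.swap Q).coeff i).coeff j = (Q.coeff j).coeff i := by
  induction Q using Polynomial.induction_on' with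
  | add p q hp hq => simp only [map_add, coeff_add, hp, hq]
  | monomial n f =>
    induction f using Polynomial.induction_on' with
    | add p q hp hq => simp only [map_add, coeff_add, hp, hq]
    | monomial k a =>
      rw [Bivariate.swap_monomial_monomial]
      simp only [coeff_monomial]
      split_ifs <;> simp [coeff_monomial, *]

/-- Only the constant coefficient in `x` reaches degree `ν` in `t`, so the leading coefficient in
`t` is the constant `±1`. -/
theorem exists_specialization (hd : 1 ≤ d) (hm : 1 ≤ m) : ∃ Ψ : ℤ[X][X],
    C ((d : FracClosure ℤ[X]) ^ ((exactPts d m).card / (d + 1))) * cyclePoly d m =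
      specialize Ψ (d * cParam) ∧ (Ψ.Monic ∨ (-Ψ).Monic) := by
  set ν := (exactPts d m).card
  have hlift : C ((d : FracClosure ℤ[X]) ^ (ν / (d + 1))) * cyclePoly d m ∈
      lifts (evalAt (d * cParam)) := by
    rw [lifts_iff_coeff_lifts]
    intro j
    rw [coeff_C_mul]
    exact exists_lift_coeff hd hm j
  obtain ⟨Q, hQ⟩ := hlift
  rw [coe_mapRingHom] at hQ
  have hcoeff : ∀ j, evalAt (d * cParam) (Q.coeff j) =
      d ^ (ν / (d + 1)) * (cyclePoly d m).coeff j := fun j => by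
    rw [← coeff_map, hQ, coeff_C_mul]
  have h0 : UnitLeading (Q.coeff 0) ν := unitLeading_of_evalAt_eq hd hm (hcoeff 0)
  have hle : ∀ j, (Q.coeff j).natDegree ≤ ((cycles d m).card - j) * m := fun j =>
    natDegree_le_of_evalAt_eq hd hm (hcoeff j)
  have hcard : (cycles d m).card * m = ν := card_mul_card_cycles hd hm
  have hdeg : (Bivariate.swap Q).natDegree ≤ ν := by
    rw [natDegree_le_iff_coeff_eq_zero]
    intro i hi
    ext j
    rw [coeff_coeff_swap, coeff_zero]
    refine coeff_eq_zero_of_natDegree_lt ((hle j).trans_lt ?_)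
    calc _ ≤ (cycles d m).card * m := Nat.mul_le_mul_right _ (Nat.sub_le _ _)
      _ < i := by omega
  have hlead : (Bivariate.swap Q).coeff ν = C (Q.coeff 0).leadingCoeff := by
    ext j
    rw [coeff_coeff_swap, coeff_C]
    split_ifs with hj
    · rw [hj, leadingCoeff, h0.2]
    -- Without cycles the degree bound is not strict for `j > 0`, but then `cyclePoly` has degree
    -- `0` and these coefficients vanish.
    · by_cases hn : (cycles d m).card = 0
      · rw [hn, zero_mul] at hcard
        have hz : evalAt (d * cParam) (Q.coeff j) = 0 := by
          rw [hcoeff, coeff_eq_zero_of_natDegree_lt, mul_zero]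
          rw [natDegree_cyclePoly, hn]; omega
        rw [(map_eq_zero_iff _ (evalAt_natCast_mul_cParam_injective hd)).1 hz, coeff_zero]
      · refine coeff_eq_zero_of_natDegree_lt ((hle j).trans_lt ?_)
        rw [← hcard]
        exact Nat.mul_lt_mul_of_pos_right (by omega) hm
  refine ⟨Bivariate.swap Q, by rw [specialize_swap, hQ], ?_⟩
  rcases Int.isUnit_iff.1 h0.1 with h | h
  · left
    exact monic_of_natDegree_le_of_coeff_eq_one ν hdeg (by rw [hlead, h, C_1])
  · right
    refine monic_of_natDegree_le_of_coeff_eq_one ν (by rwa [natDegree_neg]) ?_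
    rw [coeff_neg, hlead, h, C_neg, C_1, neg_neg]

end Specialization

end MultiplierPoly

end

theorem theorem1p6 (d m : ℕ) (hd : 1 ≤ d) (hm : 1 ≤ m) :
    (∃! Φ : Polynomial (Polynomial ℤ),
      MultiplierPoly.IsDynatomic (MultiplierPoly.family d) m Φ) ∧
    (∃! δ : Polynomial (MultiplierPoly.FracClosure (Polynomial ℤ)),
      MultiplierPoly.IsMultiplierPolynomial (MultiplierPoly.family d) m δ) ∧
    ∀ (Φ : Polynomial (Polynomial ℤ))
      (δ : Polynomial (MultiplierPoly.FracClosure (Polynomial ℤ))),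
      MultiplierPoly.IsDynatomic (MultiplierPoly.family d) m Φ →
      MultiplierPoly.IsMultiplierPolynomial (MultiplierPoly.family d) m δ →
      (d + 1) ∣ Φ.natDegree ∧
      ∃ Ψ : Polynomial (Polynomial ℤ),
        Polynomial.C ((d : MultiplierPoly.FracClosure (Polynomial ℤ)) ^
            (Φ.natDegree / (d + 1))) * δ =
          MultiplierPoly.specialize Ψ (d * MultiplierPoly.cParam) ∧
        (Ψ.Monic ∨ (-Ψ).Monic) := by
  open MultiplierPoly in
  refine ⟨?_, ?_, fun Φ δ hΦ hδ => ?_⟩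
  · obtain ⟨Φ, hΦ⟩ := exists_dynatomic_factor hd m hm
    have h := isDynatomic_of_map_eq hd hm hΦ
    exact ⟨Φ, h, fun Φ' h' => isDynatomic_unique h' h⟩
  · exact ⟨cyclePoly d m, (isMultiplierPolynomial_iff hd hm).2 rfl,
      fun δ hδ => (isMultiplierPolynomial_iff hd hm).1 hδ⟩
  · rw [natDegree_of_isDynatomic hd hm hΦ, (isMultiplierPolynomial_iff hd hm).1 hδ]
    exact ⟨succ_dvd_card_exactPts hd hm, exists_specialization hd hm⟩
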